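/- Let $N$ be an odd composite positive integer, let $m$ be an integer prime to $N$, let $P$ be the multiplicative order of $m$ modulo $N$ (the period of $f(a)=m^a \bmod N$), and let $Q=2^L$ be the power of $2$ with $N^2\le Q<2N^2$. Write $S_Q=\{0,1,\dots,Q-1\}$, $\omega=e^{2\pi i/Q}$, and let $\mathcal F=Q^{-1/2}(\omega^{xy})_{x,y\in S_Q}$ be the $Q$-point Fourier transform. One run of the quantum part of Shor's algorithm starts with two $L$-qubit registers in the state $|0\rangle|0\rangle$, applies $\mathcal F$ to the first register, applies the unitary $U_f:|x\rangle|b\rangle\mapsto|x\rangle|b+f(x)\bmod Q\rangle$ (so that $|x\rangle|0\rangle\mapsto|x\rangle|f(x)\rangle$), applies $\mathcal F$ to the first register again, and finally (STEP 2.4) measures the first register in the standard basis, which yields a random $y\in S_Q$. Let $\{a\}_Q$ denote the residue of $a$ modulo $Q$ in $(-Q/2,Q/2]$, let $Y=\{y\in S_Q : |\{Py\}_Q|\le P/2\}$, and let $d(y)=\mathrm{round}(Py/Q)$. Let $\lg$ be the logarithm to base $2$ and $\gamma$ Euler's constant. (1) There is a monotone decreasing sequence $\epsilon(1)\ge\epsilon(2)\ge\cdots$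 of positive reals converging to $0$ (the same for all $N$ and $m$) such that, for all $N$ and $m$ as above, $$\mathrm{Prob}\{y\in Y \mid \gcd(d(y),P)=1\}\ \ge\ \frac{4}{\pi^2\ln 2}\cdot\frac{e^{-\gamma}-\epsilon(P)}{\lg\lg N}\cdot\left(1-\frac1N\right)^2 ,$$ where the left-hand side is the probability that the measured $y$ lies in $Y$ and satisfies $\gcd(d(y),P)=1$. (2) This probability is $\Omega(1/\lg\lg N)$, uniformly in $m$: there is a constant $c>0$ such that it is at least $c/\lg\lg N$ for all $N$ and $m$ as above. (3) $O(\lg\lg N)$ repetitions succeed with probability $\Omega(1)$: for every constant $C>0$ there is a constant $\delta>0$ such that, for all $N$ and $m$ as above, among $\lceil C\lg\lg N\rceil$ independent runs at least one yields a $y\in Y$ with $\gcd(d(y),P)=1$ with probability at least $\delta$. -/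

import Mathlib

open scoped Matrix Kronecker

noncomputable section

namespace Shor

/-- The label set `S_Q = {0, …, Q - 1}` of the standard basis of an `L`-qubit register,
where `Q = 2 ^ L`. -/
abbrev Reg (L : ℕ) : Type := Fin (2 ^ L)

/-- Amplitudes, in the standard basis, of a state of two `L`-qubit registers. -/
abbrev State (L : ℕ) : Type := Reg L × Reg L → ℂ

/-- The root of unity `ω = e^{2πi/Q}`, `Q = 2 ^ L`. -/
def omega (L : ℕ) : ℂ := Complex.exp (2 * Real.pi * Complex.I / ((2 ^ L : ℕ) : ℂ))

/-- The `Q`-point Fourier transform `Q^{-1/2} (ω^{xy})`. -/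
def fourier (L : ℕ) : Matrix (Reg L) (Reg L) ℂ :=
  Matrix.of fun y x => ((Real.sqrt ((2 ^ L : ℕ) : ℝ) : ℝ) : ℂ)⁻¹ * omega L ^ ((x : ℕ) * (y : ℕ))

/-- The unitary `U_f : |x⟩|b⟩ ↦ |x⟩|b + f(x) mod Q⟩`; in particular `|x⟩|0⟩ ↦ |x⟩|f(x)⟩`
whenever `f` takes values below `Q`. -/
def oracle (L : ℕ) (f : ℕ → ℕ) : Matrix (Reg L × Reg L) (Reg L × Reg L) ℂ :=
  Matrix.of fun p s => if p = (s.1, s.2 + Fin.ofNat (2 ^ L) (f s.1)) then 1 else 0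

/-- `|0⟩|0⟩`. -/
def psi0 (L : ℕ) : State L := Pi.single (0, 0) 1

/-- The Fourier transform applied to the first register of `|0⟩|0⟩`. -/
def psi1 (L : ℕ) : State L :=
  (fourier L ⊗ₖ (1 : Matrix (Reg L) (Reg L) ℂ)) *ᵥ psi0 L

/-- The state after the application of `U_f`. -/
def psi2 (L : ℕ) (f : ℕ → ℕ) : State L := oracle L f *ᵥ psi1 L

/-- The state after the second Fourier transform of the first register. -/
def psi3 (L : ℕ) (f : ℕ → ℕ) : State L :=
  (fourier L ⊗ₖ (1 : Matrix (Reg L) (Reg L) ℂ)) *ᵥ psi2 L f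

/-- Born rule for the measurement of the first register: the outcome `y` has probability
`‖(|y⟩⟨y| ⊗ I) ψ₃‖²`. -/
def prob (L : ℕ) (f : ℕ → ℕ) (y : Reg L) : ℝ := ∑ b, ‖psi3 L f (y, b)‖ ^ 2

lemma prob_nonneg (L : ℕ) (f : ℕ → ℕ) (y : Reg L) : 0 ≤ prob L f y :=
  Finset.sum_nonneg fun _ _ => by positivity

lemma sum_norm_sq_mulVec {ι : Type*} [Fintype ι] [DecidableEq ι] (U : Matrix ι ι ℂ)
    (hU : Uᴴ * U = 1) (v : ι → ℂ) : ∑ i, ‖(U *ᵥ v) i‖ ^ 2 = ∑ i, ‖v i‖ ^ 2 := by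
  have key : ∀ w : ι → ℂ, ((∑ i, ‖w i‖ ^ 2 : ℝ) : ℂ) = star w ⬝ᵥ w := by
    intro w
    simp only [dotProduct, Pi.star_apply, RCLike.star_def, Complex.conj_mul']
    push_cast
    rfl
  have h : star (U *ᵥ v) ⬝ᵥ (U *ᵥ v) = star v ⬝ᵥ v := by
    rw [Matrix.star_mulVec, ← Matrix.dotProduct_mulVec, Matrix.mulVec_mulVec, hU,
      Matrix.one_mulVec]
  rw [← key, ← key] at h
  exact_mod_cast h

lemma omega_primitive (L : ℕ) : IsPrimitiveRoot (omega L) (2 ^ L) :=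
  Complex.isPrimitiveRoot_exp _ (by positivity)

lemma fourier_unitary (L : ℕ) : (fourier L)ᴴ * fourier L = 1 := by
  have hω := omega_primitive L
  have hn : ‖omega L‖ = 1 := hω.norm'_eq_one (by positivity)
  have hne : omega L ≠ 0 := hω.ne_zero (by positivity)
  have hconj : (starRingEnd ℂ) (omega L) = (omega L)⁻¹ := (Complex.inv_eq_conj hn).symm
  have hQ : (((2 ^ L : ℕ) : ℝ)) ≠ 0 := by positivity
  have hs : ((Real.sqrt ((2 ^ L : ℕ) : ℝ) : ℝ) : ℂ) * ((Real.sqrt ((2 ^ L : ℕ) : ℝ) : ℝ) : ℂ)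
      = ((2 ^ L : ℕ) : ℂ) := by
    rw [← Complex.ofReal_mul, Real.mul_self_sqrt (by positivity)]
    push_cast; rfl
  ext a b
  have hterm : ∀ y : Reg L, (fourier L)ᴴ a y * fourier L y b
      = ((2 ^ L : ℕ) : ℂ)⁻¹ * ((omega L ^ (a : ℕ))⁻¹ * omega L ^ (b : ℕ)) ^ (y : ℕ) := by
    intro y
    simp only [Matrix.conjTranspose_apply, fourier, Matrix.of_apply, star_mul', RCLike.star_def,
      map_pow, map_inv₀, Complex.conj_ofReal, hconj]
    rw [← hs, mul_pow, ← pow_mul, inv_pow, inv_pow, ← pow_mul, mul_inv]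
    ring
  rw [Matrix.mul_apply, Finset.sum_congr rfl fun y _ => hterm y, ← Finset.mul_sum,
    Fin.sum_univ_eq_sum_range (fun k => ((omega L ^ (a : ℕ))⁻¹ * omega L ^ (b : ℕ)) ^ k)]
  by_cases hab : a = b
  · subst hab
    rw [inv_mul_cancel₀ (pow_ne_zero _ hne)]
    simp
  · rw [Matrix.one_apply_ne hab]
    set z := (omega L ^ (a : ℕ))⁻¹ * omega L ^ (b : ℕ) with hz
    have hz1 : z ≠ 1 := by
      intro h
      have h2 : omega L ^ (a : ℕ) = omega L ^ (b : ℕ) := by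
        have := congrArg (fun t => omega L ^ (a : ℕ) * t) h
        simp only [hz, mul_one] at this
        rw [mul_inv_cancel_left₀ (pow_ne_zero _ hne)] at this
        exact this.symm
      exact hab (Fin.ext (hω.pow_inj a.2 b.2 h2))
    have hzQ : z ^ (2 ^ L) = 1 := by
      rw [hz, mul_pow, inv_pow, ← pow_mul, ← pow_mul, mul_comm (a : ℕ), mul_comm (b : ℕ),
        pow_mul, pow_mul, hω.pow_eq_one]
      simp
    rw [geom_sum_eq hz1, hzQ]
    simp

lemma fourier_kron_unitary (L : ℕ) :
    (fourier L ⊗ₖ (1 : Matrix (Reg L) (Reg L) ℂ))ᴴ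
      * (fourier L ⊗ₖ (1 : Matrix (Reg L) (Reg L) ℂ)) = 1 := by
  rw [Matrix.conjTranspose_kronecker, ← Matrix.mul_kronecker_mul, fourier_unitary]
  simp

lemma oracle_unitary (L : ℕ) (f : ℕ → ℕ) : (oracle L f)ᴴ * oracle L f = 1 := by
  ext ⟨x, b⟩ ⟨x', b'⟩
  simp only [Matrix.mul_apply, Matrix.conjTranspose_apply, oracle, Matrix.of_apply,
    apply_ite star, star_one, star_zero, ite_mul, one_mul, zero_mul, Finset.sum_ite_eq',
    Finset.mem_univ, if_true, Matrix.one_apply]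
  congr 1
  simp only [Prod.mk.injEq, eq_iff_iff]
  constructor
  · rintro ⟨rfl, h⟩
    exact ⟨rfl, add_right_cancel h⟩
  · rintro ⟨rfl, rfl⟩
    exact ⟨rfl, rfl⟩

lemma sum_prob (L : ℕ) (f : ℕ → ℕ) : ∑ y, prob L f y = 1 := by
  have h0 : ∑ p, ‖psi0 L p‖ ^ 2 = 1 := by
    rw [Finset.sum_eq_single (0, 0)]
    · simp [psi0]
    · intro p _ hp
      simp [psi0, Pi.single_eq_of_ne hp]
    · simp
  unfold prob
  rw [← Fintype.sum_prod_type' (fun y b => ‖psi3 L f (y, b)‖ ^ 2)]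
  unfold psi3 psi2 psi1
  rw [sum_norm_sq_mulVec _ (fourier_kron_unitary L), sum_norm_sq_mulVec _ (oracle_unitary L f),
    sum_norm_sq_mulVec _ (fourier_kron_unitary L), h0]

/-- The stochastic source: the distribution of the measured outcome `y ∈ S_Q`. -/
def source (L : ℕ) (f : ℕ → ℕ) : PMF (Reg L) :=
  PMF.ofFintype (fun y => ENNReal.ofReal (prob L f y)) (by
    rw [← ENNReal.ofReal_sum_of_nonneg fun y _ => prob_nonneg L f y, sum_prob, ENNReal.ofReal_one])

/-- The function `a ↦ m ^ a mod N`. -/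
def modExp (N m : ℕ) (a : ℕ) : ℕ := m ^ a % N

/-- The residue of `a` modulo `Q` in the interval `(-Q/2, Q/2]`. -/
def residue (Q : ℕ) (a : ℤ) : ℤ := a - Q * ⌈(a : ℚ) / Q - 1 / 2⌉

/-- `Y = {y ∈ S_Q : |{Py}_Q| ≤ P/2}`. -/
def Y (L P : ℕ) : Set (Reg L) :=
  {y | |((residue (2 ^ L) ((P : ℤ) * ((y : ℕ) : ℤ)) : ℤ) : ℚ)| ≤ (P : ℚ) / 2}

/-- `d(y) = round (P y / Q)`. -/
def d (L P : ℕ) (y : Reg L) : ℤ := round ((P : ℚ) / ((2 ^ L : ℕ) : ℚ) * ((y : ℕ) : ℚ))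

/-- The event `{y ∈ Y : gcd(d(y), P) = 1}`. -/
def good (L P : ℕ) : Set (Reg L) := {y | y ∈ Y L P ∧ Int.gcd (d L P y) P = 1}

/-- `N` is an odd composite number, `m` is prime to `N`, and `Q = 2 ^ L` satisfies
`N² ≤ Q < 2N²`. -/
structure Setup (N m L : ℕ) : Prop where
  odd : Odd N
  one_lt : 1 < N
  not_prime : ¬ N.Prime
  coprime : Nat.Coprime m N
  le_Q : N ^ 2 ≤ 2 ^ L
  Q_lt : 2 ^ L < 2 * N ^ 2

/-- The period of `a ↦ m ^ a mod N`: the multiplicative order of `m` modulo `N`. -/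
def period (N m : ℕ) : ℕ := orderOf (m : ZMod N)

/-- Probability that one run yields an outcome in `{y ∈ Y : gcd(d(y), P) = 1}`. -/
def goodProb (N m L : ℕ) : ℝ :=
  (source L (modExp N m)).toMeasure.real (good L (period N m))

/-- Probability that at least one of `k` independent runs yields an outcome in
`{y ∈ Y : gcd(d(y), P) = 1}`. -/
def successProb (N m L k : ℕ) : ℝ :=
  (MeasureTheory.Measure.pi fun _ : Fin k => (source L (modExp N m)).toMeasure).real
    {ys | ∃ i, ys i ∈ good L (period N m)}

/-- `lg lg N`, with `lg` the logarithm to base `2`. -/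
def lglg (N : ℕ) : ℝ := Real.logb 2 (Real.logb 2 N)

end Shor

end

/-! Write P for the period. For each d < P prime to P, the integer y nearest to dQ/P lies in Y and
rounds back to d, so there are φ(P) distinct good outcomes. For such a y, the amplitude on each
residue class mod P is a geometric sum whose terms span barely more than a half-circle at worst.
They add up coherently enough to give y probability at least 4/(π²P)·(1 - 1/N)² (`le_prob`). Hence
one run succeeds with probability at least 4/π²·φ(P)/P·(1 - 1/N)² (`totient_div_le_goodProb`).

The rest is Landau's bound liminf φ(n) log log n / n ≥ e^{-γ}
(`eventually_le_totient_div_mul_log_log`), combined with log log P ≤ ln 2 · lg lg N. The primes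
above log n hardly affect φ(n)/n, and those below are controlled by Mertens' third theorem. To get
its constant, the first theorem and partial summation show that ∑_{k<n} Λ(k)/(k log k) - log log n
converges to some C. An Abelian argument finds C: the difference of this sum up to e^u and the
harmonic sum up to u tends to C - γ, while its exponential averages equal log ζ(1+t) + log(1 -
e^{-t}), which tends to 0 as t → 0+.

The uniform bound c / lg lg N uses this for large P and φ(P) ≥ 1 for the remaining bounded P.
Repetition uses (1-p)^k ≤ e^{-pk}. -/

namespace Mertens

open Filter Topology Finset ArithmeticFunction

/-! ### Mertens' first theorem and partial summation. -/

/-- **The first theorem of Mertens**, for the von Mangoldt function. -/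
theorem exists_abs_sum_vonMangoldt_div_sub_log_le :
    ∃ b : ℝ, ∀ n : ℕ, |∑ k ∈ Ioc 0 n, Λ k / k - Real.log n| ≤ b := by
  refine ⟨Real.log 4 + 4, fun n => ?_⟩
  have h4 : 0 ≤ Real.log 4 := Real.log_nonneg (by norm_num)
  rcases Nat.eq_zero_or_pos n with rfl | hn
  · simp; positivity
  have hn' : (0 : ℝ) < n := by exact_mod_cast hn
  -- Sum Λ * ζ = log over 1, …, n; the quotient n / k is the floor. Stirling evaluates the left
  -- side.
  have hfac : Real.log (n.factorial : ℝ) = ∑ k ∈ Ioc 0 n, Λ k * ((n / k : ℕ) : ℝ) := by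
    rw [← sum_Ioc_mul_zeta_eq_sum, vonMangoldt_mul_zeta]
    simp only [log_apply]
    clear hn hn'
    induction n with
    | zero => simp
    | succ n ih =>
      rw [Nat.factorial_succ, Nat.cast_mul,
        Real.log_mul (by positivity) (by positivity), ih,
        Finset.sum_Ioc_succ_top (by omega), add_comm]
  have hlow : n * Real.log n - n ≤ Real.log (n.factorial : ℝ) := by
    have := Stirling.le_log_factorial_stirling hn.ne'
    have h1 : 0 ≤ Real.log n := Real.log_natCast_nonneg n
    have h2 : 0 ≤ Real.log (2 * Real.pi) := Real.log_nonneg (by linarith [Real.pi_gt_three])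
    linarith
  have hup : Real.log (n.factorial : ℝ) ≤ n * Real.log n := by
    rw [← Real.log_pow]
    exact Real.log_le_log (by positivity) (by exact_mod_cast Nat.factorial_le_pow n)
  have hmul : n * ∑ k ∈ Ioc 0 n, Λ k / k = ∑ k ∈ Ioc 0 n, Λ k * ((n : ℝ) / k) := by
    rw [Finset.mul_sum]
    exact Finset.sum_congr rfl fun k _ => by ring
  have hA : Real.log (n.factorial : ℝ) ≤ n * ∑ k ∈ Ioc 0 n, Λ k / k := by
    rw [hfac, hmul]
    exact Finset.sum_le_sum fun k _ => mul_le_mul_of_nonneg_left Nat.cast_div_le vonMangoldt_nonneg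
  -- Removing the floors costs at most ψ(n), and log 4 + 4 is Chebyshev's constant for ψ.
  have hB : n * ∑ k ∈ Ioc 0 n, Λ k / k ≤ Real.log (n.factorial : ℝ) + (Real.log 4 + 4) * n := by
    have hpsi := Chebyshev.psi_le_const_mul_self hn'.le
    rw [Chebyshev.psi, Nat.floor_natCast] at hpsi
    refine le_trans ?_ (add_le_add_right hpsi _)
    rw [hfac, hmul, ← Finset.sum_add_distrib]
    refine Finset.sum_le_sum fun k _ => ?_
    have : (n : ℝ) / k ≤ ((n / k : ℕ) : ℝ) + 1 := by
      rw [← Nat.floor_div_eq_div (K := ℝ)]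
      exact (Nat.lt_floor_add_one _).le
    nlinarith [vonMangoldt_nonneg (n := k)]
  rw [abs_le]
  constructor
  · have : (n : ℝ) * (Real.log n - 1) ≤ n * ∑ k ∈ Ioc 0 n, Λ k / k := by linarith
    have := le_of_mul_le_mul_left this hn'
    linarith
  · have : (n : ℝ) * ∑ k ∈ Ioc 0 n, Λ k / k ≤ n * (Real.log n + (Real.log 4 + 4)) := by linarith
    have := le_of_mul_le_mul_left this hn'
    linarith

/-- The coefficients `Λ n / (n log n)` of the logarithm of the zeta function at `1`. -/
noncomputable def logZetaCoeff (n : ℕ) : ℝ := Λ n / (n * Real.log n)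

lemma logZetaCoeff_nonneg (n : ℕ) : 0 ≤ logZetaCoeff n :=
  div_nonneg vonMangoldt_nonneg (mul_nonneg n.cast_nonneg (Real.log_natCast_nonneg n))

/-- Apply 1 - 1/x ≤ log x ≤ x - 1 to x = log(n+1)/log n. The upper bound telescopes, so the errors
of replacing increments of log log by Δlog/log are summable. -/
lemma log_log_increment {n : ℕ} (hn : 2 ≤ n) :
    0 ≤ Real.log (Real.log (n + 1)) - Real.log (Real.log n)
        - (Real.log (n + 1) - Real.log n) / Real.log (n + 1) ∧
      Real.log (Real.log (n + 1)) - Real.log (Real.log n)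
        - (Real.log (n + 1) - Real.log n) / Real.log (n + 1)
        ≤ 1 / Real.log n - 1 / Real.log (n + 1) ∧
      0 ≤ Real.log (n + 1) - Real.log n ∧ Real.log (n + 1) - Real.log n ≤ 1 := by
  have hn1 : (1 : ℝ) < n := by exact_mod_cast hn
  have ha : 0 < Real.log n := Real.log_pos hn1
  have hab : Real.log n ≤ Real.log (n + 1) := Real.log_le_log (by linarith) (by linarith)
  have hb : 0 < Real.log ((n : ℝ) + 1) := ha.trans_le hab
  have hb1 : Real.log (n + 1) - Real.log n ≤ 1 := by
    rw [← Real.log_div (by linarith) (by linarith)]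
    refine (Real.log_le_sub_one_of_pos (by positivity)).trans ?_
    rw [sub_le_iff_le_add, div_le_iff₀ (by linarith)]
    linarith
  set a := Real.log n
  set b := Real.log ((n : ℝ) + 1)
  rw [← Real.log_div hb.ne' ha.ne']
  have h1 := Real.one_sub_inv_le_log_of_pos (div_pos hb ha)
  have h2 := Real.log_le_sub_one_of_pos (div_pos hb ha)
  have e1 : 1 - (b / a)⁻¹ = (b - a) / b := by field_simp
  have e2 : b / a - 1 = (b - a) / a := by field_simp
  refine ⟨by linarith, ?_, by linarith, hb1⟩
  have e3 : (b - a) / a - (b - a) / b = (b - a) * (1 / a - 1 / b) := by ring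
  have h3 : 0 ≤ 1 / a - 1 / b := sub_nonneg.2 (one_div_le_one_div_of_le ha hab)
  nlinarith

lemma tendsto_inv_log_add (c : ℕ) :
    Tendsto (fun n : ℕ => 1 / Real.log ((n + c : ℕ) : ℝ)) atTop (𝓝 0) := by
  have h : Tendsto (fun n : ℕ => Real.log ((n + c : ℕ) : ℝ)) atTop atTop :=
    Real.tendsto_log_atTop.comp (tendsto_natCast_atTop_atTop.comp (tendsto_add_atTop_nat c))
  simp only [one_div]
  exact h.inv_tendsto_atTop

lemma tendsto_log_log_add_one_sub :
    Tendsto (fun n : ℕ => Real.log (Real.log (n + 1)) - Real.log (Real.log n)) atTop (𝓝 0) := by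
  refine squeeze_zero' (g := fun n : ℕ => 1 / Real.log ((n + 0 : ℕ) : ℝ)) ?_ ?_
    (tendsto_inv_log_add 0)
  · filter_upwards [eventually_ge_atTop 2] with n hn
    obtain ⟨h1, -, h3, -⟩ := log_log_increment hn
    have hb : 0 ≤ Real.log ((n : ℝ) + 1) := by exact_mod_cast Real.log_natCast_nonneg (n + 1)
    have := div_nonneg h3 hb
    linarith
  · filter_upwards [eventually_ge_atTop 2] with n hn
    obtain ⟨-, h2, h3, h4⟩ := log_log_increment hn
    have hb : 0 ≤ Real.log ((n : ℝ) + 1) := by exact_mod_cast Real.log_natCast_nonneg (n + 1)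
    have := div_le_div_of_nonneg_right h4 hb
    simp only [add_zero]
    linarith

/-- The partial sums of `Λ k / (k log k)` are `log log n` up to a convergent error. -/
theorem exists_tendsto_sum_logZetaCoeff_sub_log_log :
    ∃ C : ℝ, Tendsto (fun n : ℕ => ∑ k ∈ range n, logZetaCoeff k - Real.log (Real.log n))
      atTop (𝓝 C) := by
  obtain ⟨b, hb⟩ := exists_abs_sum_vonMangoldt_div_sub_log_le
  -- Increments of the error in the first theorem, so their partial sums are bounded; Dirichlet's
  -- test then applies with weights 1/log. Starting at 3 keeps log(i + 2) positive.
  set z : ℕ → ℝ := fun i => Λ (i + 3) / (i + 3 : ℕ) - (Real.log (i + 3 : ℕ) - Real.log (i + 2 : ℕ))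
    with hz
  have hzsum : ∀ n, ∑ i ∈ range n, z i = (∑ k ∈ Ioc 0 (n + 2), Λ k / k - Real.log (n + 2 : ℕ))
      - (∑ k ∈ Ioc 0 2, Λ k / k - Real.log (2 : ℕ)) := by
    intro n
    induction n with
    | zero => simp
    | succ n ih =>
      rw [Finset.sum_range_succ, ih, show n + 1 + 2 = n + 2 + 1 by ring,
        Finset.sum_Ioc_succ_top (b := n + 2) (by omega)]
      simp only [hz]
      ring
  have hanti : Antitone fun n : ℕ => 1 / Real.log ((n + 3 : ℕ) : ℝ) := by
    intro i j hij
    refine one_div_le_one_div_of_le (Real.log_pos (by push_cast; linarith [i.cast_nonneg (α := ℝ)]))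
      (Real.log_le_log (by positivity) (by exact_mod_cast (by omega : i + 3 ≤ j + 3)))
  have hU := hanti.cauchySeq_series_mul_of_tendsto_zero_of_bounded (z := z) (b := b + b)
    (tendsto_inv_log_add 3) fun n => by
      rw [hzsum]
      exact (norm_sub_le _ _).trans (add_le_add (hb _) (hb _))
  obtain ⟨U, hU⟩ := cauchySeq_tendsto_of_complete hU
  set w : ℕ → ℝ := fun i => Real.log (Real.log (i + 3 : ℕ)) - Real.log (Real.log (i + 2 : ℕ))
    - (Real.log (i + 3 : ℕ) - Real.log (i + 2 : ℕ)) / Real.log (i + 3 : ℕ) with hw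
  have hinc : ∀ i : ℕ, 0 ≤ w i ∧
      w i ≤ 1 / Real.log (i + 2 : ℕ) - 1 / Real.log (i + 1 + 2 : ℕ) := by
    intro i
    obtain ⟨h1, h2, -, -⟩ := log_log_increment (show 2 ≤ i + 2 by omega)
    have e : (((i + 2 : ℕ) : ℝ) + 1) = ((i + 3 : ℕ) : ℝ) := by push_cast; ring
    rw [e] at h1 h2
    exact ⟨h1, h2⟩
  have hV : Summable w := by
    refine summable_of_sum_range_le (c := 1 / Real.log (2 : ℕ)) (fun i => (hinc i).1) fun n => ?_
    refine (Finset.sum_le_sum fun i _ => (hinc i).2).trans ?_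
    rw [Finset.sum_range_sub' (fun i : ℕ => 1 / Real.log ((i + 2 : ℕ) : ℝ))]
    have : 0 ≤ 1 / Real.log ((n + 2 : ℕ) : ℝ) := one_div_nonneg.2 (Real.log_natCast_nonneg _)
    simp only [zero_add]
    linarith
  have hV' := hV.hasSum.tendsto_sum_nat
  have key : ∀ n, ∑ k ∈ range (n + 3), logZetaCoeff k - Real.log (Real.log (n + 2 : ℕ))
      = (∑ k ∈ range 3, logZetaCoeff k - Real.log (Real.log (2 : ℕ)))
        + (∑ i ∈ range n, (1 / Real.log ((i + 3 : ℕ) : ℝ)) • z i - ∑ i ∈ range n, w i) := by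
    intro n
    induction n with
    | zero => simp
    | succ n ih =>
      rw [show n + 1 + 3 = n + 3 + 1 by ring, Finset.sum_range_succ, Finset.sum_range_succ _ n,
        Finset.sum_range_succ w n]
      rw [sub_eq_iff_eq_add] at ih
      rw [ih]
      simp only [logZetaCoeff, hz, hw, smul_eq_mul]
      rw [show n + 1 + 2 = n + 3 by ring]
      have h3 : Real.log ((n + 3 : ℕ) : ℝ) ≠ 0 :=
        (Real.log_pos (by push_cast; linarith [n.cast_nonneg (α := ℝ)])).ne'
      field_simp
      ring
  have h1 : Tendsto (fun n : ℕ => ∑ k ∈ range (n + 3), logZetaCoeff k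
      - Real.log (Real.log (n + 2 : ℕ))) atTop
      (𝓝 ((∑ k ∈ range 3, logZetaCoeff k - Real.log (Real.log (2 : ℕ))) + (U - ∑' i, w i))) :=
    ((hU.sub hV').const_add _).congr fun n => (key n).symm
  -- `key` pairs the sum over k < n + 3 with log log (n + 2); the shift by one is corrected by a
  -- null sequence.
  refine ⟨_, (tendsto_add_atTop_iff_nat 3).1 ((h1.sub
    (tendsto_log_log_add_one_sub.comp (tendsto_add_atTop_nat 2))).congr fun n => ?_)⟩
  have e : (((n + 2 : ℕ) : ℝ) + 1) = ((n + 3 : ℕ) : ℝ) := by push_cast; ring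
  simp only [Function.comp_apply, e]
  ring

end Mertens

/-! ### Exponential averages and the zeta function near 1. -/

namespace Mertens

open Filter Topology Finset ArithmeticFunction MeasureTheory

lemma integrable_indicator_Ioi_exp_neg (a c : ℝ) :
    Integrable ((Set.Ioi c).indicator fun v => a * Real.exp (-v)) (volume.restrict (Set.Ioi 0)) := by
  have h : IntegrableOn (fun v => a * Real.exp (-v)) (Set.Ioi 0) :=
    (integrableOn_exp_neg_Ioi 0).const_mul a
  exact h.integrable.indicator measurableSet_Ioi

lemma integral_indicator_Ioi_exp_neg (a : ℝ) {c : ℝ} (hc : 0 ≤ c) :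
    ∫ v in Set.Ioi 0, (Set.Ioi c).indicator (fun v => a * Real.exp (-v)) v
      = a * Real.exp (-c) := by
  rw [integral_indicator measurableSet_Ioi, Measure.restrict_restrict measurableSet_Ioi,
    Set.Ioi_inter_Ioi, sup_eq_left.2 hc, integral_const_mul, integral_exp_neg_Ioi]

/-- The difference of two exponential series with nonnegative coefficients is an integral of the
differences of their partial sums. -/
lemma hasSum_exp_sub_exp {a b l l' : ℕ → ℝ} (ha : ∀ n, 0 ≤ a n) (hb : ∀ n, 0 ≤ b n)
    (hl : ∀ n, 0 ≤ l n) (hl' : ∀ n, 0 ≤ l' n)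
    (hsa : Summable fun n => a n * Real.exp (-l n))
    (hsb : Summable fun n => b n * Real.exp (-l' n)) :
    HasSum (fun n => a n * Real.exp (-l n) - b n * Real.exp (-l' n))
      (∫ v in Set.Ioi 0, ∑' n, ((Set.Ioi (l n)).indicator (fun v => a n * Real.exp (-v)) v
        - (Set.Ioi (l' n)).indicator (fun v => b n * Real.exp (-v)) v)) := by
  have hI := fun n => integrable_indicator_Ioi_exp_neg (a n) (l n)
  have hI' := fun n => integrable_indicator_Ioi_exp_neg (b n) (l' n)
  -- Each e^{-l} is the integral of e^{-v} over v > l; absolute convergence of both series allows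
  -- the interchange.
  have h := hasSum_integral_of_summable_integral_norm (μ := volume.restrict (Set.Ioi 0))
    (F := fun n v => (Set.Ioi (l n)).indicator (fun v => a n * Real.exp (-v)) v
        - (Set.Ioi (l' n)).indicator (fun v => b n * Real.exp (-v)) v)
    (fun n => (hI n).sub (hI' n)) ?_
  · refine h.congr_fun ?_
    intro n
    rw [integral_sub (hI n) (hI' n), integral_indicator_Ioi_exp_neg _ (hl n),
      integral_indicator_Ioi_exp_neg _ (hl' n)]
  · refine Summable.of_nonneg_of_le (fun n => integral_nonneg fun v => norm_nonneg _) (fun n => ?_)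
      (hsa.add hsb)
    rw [← integral_indicator_Ioi_exp_neg _ (hl n), ← integral_indicator_Ioi_exp_neg _ (hl' n),
      ← integral_add (hI n) (hI' n)]
    refine integral_mono ((hI n).sub (hI' n)).norm ((hI n).add (hI' n)) fun v => ?_
    refine (norm_sub_le _ _).trans (le_of_eq ?_)
    rw [Real.norm_of_nonneg (Set.indicator_nonneg
        (fun v _ => mul_nonneg (ha n) (Real.exp_nonneg _)) _),
      Real.norm_of_nonneg (Set.indicator_nonneg
        (fun v _ => mul_nonneg (hb n) (Real.exp_nonneg _)) _)]

/-- The difference of `∑_{n < e^u} Λ n / (n log n)` and `∑_{n < u} 1 / n`. -/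
noncomputable def partialDiff (u : ℝ) : ℝ :=
  ∑ n ∈ range ⌈Real.exp u⌉₊, logZetaCoeff n - ∑ n ∈ range ⌈u⌉₊, (1 / n : ℝ)

lemma measurable_partialDiff : Measurable partialDiff := by
  refine Measurable.sub ?_ ?_
  · exact (measurable_from_nat (f := fun k => ∑ n ∈ range k, logZetaCoeff n)).comp
      (Nat.measurable_ceil.comp Real.measurable_exp)
  · exact (measurable_from_nat (f := fun k => ∑ n ∈ range k, (1 / n : ℝ))).comp Nat.measurable_ceil

lemma logZetaCoeff_zero : logZetaCoeff 0 = 0 := by simp [logZetaCoeff]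

/-- At fixed v only the n with t log n < v, respectively tn < v, survive, which are the cutoffs e^u
and u at u = v/t. The term n = 0 is harmless since both coefficients are 0 there. -/
lemma tsum_indicator_eq_partialDiff {t : ℝ} (ht : 0 < t) (v : ℝ) :
    ∑' n : ℕ, ((Set.Ioi (t * Real.log n)).indicator (fun v => logZetaCoeff n * Real.exp (-v)) v
        - (Set.Ioi (t * n)).indicator (fun v => (1 / n : ℝ) * Real.exp (-v)) v)
      = partialDiff (v / t) * Real.exp (-v) := by
  have h1 : HasSum (fun n : ℕ =>
      (Set.Ioi (t * Real.log n)).indicator (fun v => logZetaCoeff n * Real.exp (-v)) v)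
      (∑ n ∈ range ⌈Real.exp (v / t)⌉₊, logZetaCoeff n * Real.exp (-v)) := by
    have hmem : ∀ n : ℕ, n ≠ 0 → (v ∈ Set.Ioi (t * Real.log n) ↔ n ∈ range ⌈Real.exp (v / t)⌉₊) := by
      intro n hn
      rw [Set.mem_Ioi, Finset.mem_range, Nat.lt_ceil, ← Real.log_lt_iff_lt_exp (by positivity),
        lt_div_iff₀' ht]
    rw [← Finset.sum_congr rfl fun n hn => ?_]
    · refine hasSum_sum_of_ne_finset_zero fun n hn => ?_
      rcases eq_or_ne n 0 with rfl | h0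
      · simp [logZetaCoeff_zero]
      · exact Set.indicator_of_notMem (fun h => hn ((hmem n h0).1 h)) _
    · rcases eq_or_ne n 0 with rfl | h0
      · simp [logZetaCoeff_zero]
      · exact Set.indicator_of_mem ((hmem n h0).2 hn) _
  have h2 : HasSum (fun n : ℕ =>
      (Set.Ioi (t * n)).indicator (fun v => (1 / n : ℝ) * Real.exp (-v)) v)
      (∑ n ∈ range ⌈v / t⌉₊, (1 / n : ℝ) * Real.exp (-v)) := by
    have hmem : ∀ n : ℕ, (v ∈ Set.Ioi (t * (n : ℝ)) ↔ n ∈ range ⌈v / t⌉₊) := by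
      intro n
      rw [Set.mem_Ioi, Finset.mem_range, Nat.lt_ceil, lt_div_iff₀' ht]
    rw [← Finset.sum_congr rfl fun n hn => ?_]
    · exact hasSum_sum_of_ne_finset_zero fun n hn =>
        Set.indicator_of_notMem (fun h => hn ((hmem n).1 h)) _
    · exact Set.indicator_of_mem ((hmem n).2 hn) _
  rw [(h1.sub h2).tsum_eq, partialDiff, sub_mul, Finset.sum_mul, Finset.sum_mul]

lemma logZetaCoeff_mul_exp (t : ℝ) (n : ℕ) :
    logZetaCoeff n * Real.exp (-(t * Real.log n)) = Λ n / ((n : ℝ) ^ (1 + t) * Real.log n) := by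
  rcases Nat.eq_zero_or_pos n with rfl | hn
  · simp [logZetaCoeff]
  have hn' : (0 : ℝ) < n := by exact_mod_cast hn
  rw [logZetaCoeff, Real.rpow_add hn', Real.rpow_one, Real.rpow_def_of_pos hn' t, Real.exp_neg,
    mul_comm (Real.log n) t]
  field_simp

lemma summable_logZetaCoeff_mul_exp {t : ℝ} (ht : 0 < t) :
    Summable fun n : ℕ => logZetaCoeff n * Real.exp (-(t * Real.log n)) := by
  refine Summable.of_nonneg_of_le
    (fun n => mul_nonneg (logZetaCoeff_nonneg n) (Real.exp_nonneg _)) (fun n => ?_)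
    (Real.summable_one_div_nat_rpow.2 (by linarith : 1 < 1 + t))
  rw [logZetaCoeff_mul_exp]
  have hp : 0 ≤ (n : ℝ) ^ (1 + t) := by positivity
  rcases (Real.log_natCast_nonneg n).eq_or_lt with h0 | hpos
  · rw [← h0]; simp; exact hp
  rw [mul_comm, ← div_div]
  exact div_le_div_of_nonneg_right ((div_le_one hpos).2 vonMangoldt_le_log) hp

lemma hasSum_one_div_mul_exp {t : ℝ} (ht : 0 < t) :
    HasSum (fun n : ℕ => (1 / n : ℝ) * Real.exp (-(t * n))) (-Real.log (1 - Real.exp (-t))) := by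
  have h := Real.hasSum_pow_div_log_of_abs_lt_one (x := Real.exp (-t))
    (by rw [abs_of_pos (Real.exp_pos _)]; exact Real.exp_lt_one_iff.2 (by linarith))
  rw [← hasSum_nat_add_iff' 1]
  simp only [Finset.sum_range_one, Nat.cast_zero, div_zero, zero_mul, sub_zero]
  refine h.congr_fun ?_
  intro n
  rw [← Real.exp_nat_mul]
  push_cast
  rw [show -(t * ((n : ℝ) + 1)) = ((n : ℝ) + 1) * -t by ring]
  ring

/-- The two series being averaged are ∑ Λ(n)/(n^{1+t} log n) = log ζ(1+t) and ∑ e^{-tn}/n = -log(1 -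
e^{-t}). -/
lemma integral_partialDiff {t : ℝ} (ht : 0 < t) :
    ∫ v in Set.Ioi 0, partialDiff (v / t) * Real.exp (-v)
      = Real.log (riemannZeta ((1 + t : ℝ) : ℂ)).re + Real.log (1 - Real.exp (-t)) := by
  have hs := hasSum_one_div_mul_exp ht
  have h := hasSum_exp_sub_exp logZetaCoeff_nonneg (b := fun n : ℕ => (1 / n : ℝ))
    (l := fun n => t * Real.log n) (l' := fun n => t * n) (fun n => by positivity)
    (fun n => mul_nonneg ht.le (Real.log_natCast_nonneg n)) (fun n => by positivity)
    (summable_logZetaCoeff_mul_exp ht) hs.summable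
  have h' := (summable_logZetaCoeff_mul_exp ht).hasSum.sub hs
  rw [setIntegral_congr_fun measurableSet_Ioi
    (fun v _ => (tsum_indicator_eq_partialDiff ht v).symm), h.unique h', sub_neg_eq_add,
    log_riemannZeta_eq (by linarith : 1 < 1 + t)]
  simp only [logZetaCoeff_mul_exp]

/-- The simple pole with residue 1 cancels the simple zero: tζ(1+t) → 1 and (1 - e^{-t})/t → 1. -/
lemma tendsto_log_zeta_add_log :
    Tendsto (fun t : ℝ => Real.log (riemannZeta ((1 + t : ℝ) : ℂ)).re
      + Real.log (1 - Real.exp (-t))) (𝓝[>] 0) (𝓝 0) := by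
  have h1 : Tendsto (fun t : ℝ => t * (riemannZeta ((1 + t : ℝ) : ℂ)).re) (𝓝[>] 0) (𝓝 1) := by
    have hc : Tendsto (fun t : ℝ => ((1 + t : ℝ) : ℂ)) (𝓝[>] 0) (𝓝[≠] 1) := by
      refine tendsto_nhdsWithin_iff.2 ⟨?_, ?_⟩
      · have : Continuous fun t : ℝ => ((1 + t : ℝ) : ℂ) := by fun_prop
        have := this.tendsto 0
        simp only [add_zero, Complex.ofReal_one] at this
        exact this.mono_left nhdsWithin_le_nhds
      · filter_upwards [self_mem_nhdsWithin] with t ht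
        simp only [Set.mem_compl_iff, Set.mem_singleton_iff]
        intro h
        have : (1 + t : ℝ) = 1 := by exact_mod_cast h
        have ht' : (0 : ℝ) < t := ht
        linarith
    have := (Complex.continuous_re.tendsto _).comp (riemannZeta_residue_one.comp hc)
    simp only [Complex.one_re] at this
    refine this.congr fun t => ?_
    simp only [Function.comp_apply]
    rw [show ((1 + t : ℝ) : ℂ) - 1 = (t : ℂ) by push_cast; ring, Complex.re_ofReal_mul]
  have h2 : Tendsto (fun t : ℝ => (1 - Real.exp (-t)) / t) (𝓝[>] 0) (𝓝 1) := by
    have hd : HasDerivAt (fun t : ℝ => 1 - Real.exp (-t)) 1 0 := by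
      have := ((hasDerivAt_neg (0 : ℝ)).exp).const_sub 1
      simpa using this
    have := (hasDerivAt_iff_tendsto_slope.1 hd).mono_left
      (nhdsWithin_mono _ (fun x (hx : 0 < x) => hx.ne' : Set.Ioi (0 : ℝ) ⊆ {0}ᶜ))
    refine this.congr fun t => ?_
    simp [slope_def_field]
  have h3 := (Real.continuousAt_log one_ne_zero).tendsto.comp
    (by simpa only [mul_one] using h1.mul h2 : Tendsto _ _ (𝓝 (1 : ℝ)))
  rw [Real.log_one] at h3
  refine h3.congr' ?_
  filter_upwards [self_mem_nhdsWithin, h1.eventually_ne one_ne_zero] with t ht hne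
  have ht' : (0 : ℝ) < t := ht
  have he : 1 - Real.exp (-t) ≠ 0 := (sub_pos.2 (Real.exp_lt_one_iff.2 (by linarith))).ne'
  rw [Function.comp_apply, ← Real.log_mul (right_ne_zero_of_mul hne) he]
  congr 1
  field_simp

end Mertens

/-! ### The constant γ and Mertens' third theorem. -/

namespace Mertens

open Filter Topology Finset ArithmeticFunction MeasureTheory

lemma tendsto_log_ceil_sub_log :
    Tendsto (fun u : ℝ => Real.log ⌈u⌉₊ - Real.log u) atTop (𝓝 0) := by
  refine squeeze_zero' (g := fun u : ℝ => u⁻¹) ?_ ?_ tendsto_inv_atTop_zero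
  · filter_upwards [eventually_gt_atTop 0] with u hu
    exact sub_nonneg.2 (Real.log_le_log hu (Nat.le_ceil u))
  · filter_upwards [eventually_gt_atTop 0] with u hu
    have hc : (0 : ℝ) < ⌈u⌉₊ := hu.trans_le (Nat.le_ceil u)
    rw [← Real.log_div hc.ne' hu.ne']
    refine (Real.log_le_sub_one_of_pos (by positivity)).trans ?_
    rw [sub_le_iff_le_add, div_le_iff₀ hu, add_mul, inv_mul_cancel₀ hu.ne']
    linarith [Nat.ceil_lt_add_one hu.le]

lemma tendsto_log_log_ceil_exp_sub_log :
    Tendsto (fun u : ℝ => Real.log (Real.log ⌈Real.exp u⌉₊) - Real.log u) atTop (𝓝 0) := by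
  refine squeeze_zero' (g := fun u : ℝ => u⁻¹) ?_ ?_ tendsto_inv_atTop_zero
  · filter_upwards [eventually_gt_atTop 0] with u hu
    refine sub_nonneg.2 (Real.log_le_log hu ?_)
    exact (Real.le_log_iff_exp_le ((Real.exp_pos u).trans_le (Nat.le_ceil _))).2 (Nat.le_ceil _)
  · filter_upwards [eventually_gt_atTop 0] with u hu
    have hc : (0 : ℝ) < ⌈Real.exp u⌉₊ := (Real.exp_pos u).trans_le (Nat.le_ceil _)
    have h1 : u ≤ Real.log ⌈Real.exp u⌉₊ := (Real.le_log_iff_exp_le hc).2 (Nat.le_ceil _)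
    have h2 : Real.log ⌈Real.exp u⌉₊ ≤ u + 1 := by
      rw [Real.log_le_iff_le_exp hc, Real.exp_add]
      nlinarith [Nat.ceil_lt_add_one (Real.exp_pos u).le, Real.add_one_le_exp u,
        Real.add_one_le_exp 1]
    rw [← Real.log_div (hu.trans_le h1).ne' hu.ne']
    refine (Real.log_le_sub_one_of_pos (div_pos (hu.trans_le h1) hu)).trans ?_
    rw [sub_le_iff_le_add, div_le_iff₀ hu, add_mul, inv_mul_cancel₀ hu.ne']
    linarith

lemma tendsto_sum_one_div_sub_log :
    Tendsto (fun n : ℕ => ∑ k ∈ range n, (1 / k : ℝ) - Real.log n) atTop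
      (𝓝 Real.eulerMascheroniConstant) := by
  refine (tendsto_add_atTop_iff_nat 1).1 (Real.tendsto_harmonic_sub_log_add_one.congr fun n => ?_)
  rw [Finset.sum_range_succ', harmonic]
  simp

/-- The cutoffs e^u and u are chosen so that both sums have main term log u, leaving only the
constants. -/
lemma tendsto_partialDiff {C : ℝ}
    (hC : Tendsto (fun n : ℕ => ∑ k ∈ range n, logZetaCoeff k - Real.log (Real.log n))
      atTop (𝓝 C)) :
    Tendsto partialDiff atTop (𝓝 (C - Real.eulerMascheroniConstant)) := by
  have hceil : Tendsto (fun u : ℝ => ⌈u⌉₊) atTop atTop := tendsto_nat_ceil_atTop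
  have h1 := (hC.comp (hceil.comp Real.tendsto_exp_atTop)).add tendsto_log_log_ceil_exp_sub_log
  have h2 := (tendsto_sum_one_div_sub_log.comp hceil).add tendsto_log_ceil_sub_log
  have h3 := h1.sub h2
  simp only [add_zero] at h3
  refine h3.congr fun u => ?_
  simp only [Function.comp_apply, partialDiff]
  ring

lemma exists_abs_partialDiff_le {l : ℝ} (h : Tendsto partialDiff atTop (𝓝 l)) :
    ∃ K, ∀ u, |partialDiff u| ≤ K := by
  obtain ⟨U, hU⟩ := eventually_atTop.1 (h.eventually (Metric.ball_mem_nhds l one_pos))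
  refine ⟨max (|l| + 1) (∑ n ∈ range ⌈Real.exp U⌉₊, logZetaCoeff n
    + ∑ n ∈ range ⌈U⌉₊, (1 / n : ℝ)), fun u => ?_⟩
  rcases le_total U u with hu | hu
  · refine le_max_of_le_left ?_
    have := hU u hu
    rw [Real.dist_eq] at this
    have h2 := abs_sub_abs_le_abs_sub (partialDiff u) l
    linarith
  · refine le_max_of_le_right ?_
    have h1 : ∑ n ∈ range ⌈Real.exp u⌉₊, logZetaCoeff n ≤ ∑ n ∈ range ⌈Real.exp U⌉₊, logZetaCoeff n :=
      Finset.sum_le_sum_of_subset_of_nonneg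
        (Finset.range_subset_range.2 (Nat.ceil_mono (Real.exp_le_exp.2 hu)))
        fun _ _ _ => logZetaCoeff_nonneg _
    have h2 : ∑ n ∈ range ⌈u⌉₊, (1 / n : ℝ) ≤ ∑ n ∈ range ⌈U⌉₊, (1 / n : ℝ) :=
      Finset.sum_le_sum_of_subset_of_nonneg (Finset.range_subset_range.2 (Nat.ceil_mono hu))
        fun _ _ _ => by positivity
    have h3 : 0 ≤ ∑ n ∈ range ⌈Real.exp u⌉₊, logZetaCoeff n :=
      Finset.sum_nonneg fun _ _ => logZetaCoeff_nonneg _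
    have h4 : 0 ≤ ∑ n ∈ range ⌈u⌉₊, (1 / n : ℝ) := Finset.sum_nonneg fun _ _ => by positivity
    rw [partialDiff, abs_le]
    constructor <;> linarith

/-- Dominated convergence: v/t → ∞ for each v > 0, and a bounded `partialDiff` gives the majorant
Ke^{-v}. -/
lemma tendsto_integral_partialDiff {l : ℝ} (h : Tendsto partialDiff atTop (𝓝 l)) :
    Tendsto (fun t : ℝ => ∫ v in Set.Ioi 0, partialDiff (v / t) * Real.exp (-v)) (𝓝[>] 0)
      (𝓝 l) := by
  obtain ⟨K, hK⟩ := exists_abs_partialDiff_le h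
  have hl : ∫ v in Set.Ioi (0 : ℝ), l * Real.exp (-v) = l := by
    rw [integral_const_mul, integral_exp_neg_Ioi_zero, mul_one]
  rw [← hl]
  refine tendsto_integral_filter_of_dominated_convergence (fun v => K * Real.exp (-v)) ?_ ?_ ?_ ?_
  · refine Eventually.of_forall fun t => Measurable.aestronglyMeasurable ?_
    exact (measurable_partialDiff.comp (measurable_id.div_const t)).mul
      (Real.measurable_exp.comp measurable_neg)
  · refine Eventually.of_forall fun t => Eventually.of_forall fun v => ?_
    rw [norm_mul, Real.norm_eq_abs, Real.norm_of_nonneg (Real.exp_nonneg _)]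
    exact mul_le_mul_of_nonneg_right (hK _) (Real.exp_nonneg _)
  · exact (integrableOn_exp_neg_Ioi 0).const_mul K
  · refine (ae_restrict_mem measurableSet_Ioi).mono fun v (hv : 0 < v) => ?_
    refine (h.comp ?_).mul_const _
    exact tendsto_inv_nhdsGT_zero.const_mul_atTop hv

/-- `∑_{k < n} Λ k / (k log k) = log log n + γ + o(1)`. -/
theorem tendsto_sum_logZetaCoeff_sub_log_log :
    Tendsto (fun n : ℕ => ∑ k ∈ range n, logZetaCoeff k - Real.log (Real.log n)) atTop
      (𝓝 Real.eulerMascheroniConstant) := by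
  obtain ⟨C, hC⟩ := exists_tendsto_sum_logZetaCoeff_sub_log_log
  have h := tendsto_integral_partialDiff (tendsto_partialDiff hC)
  have h0 : Tendsto (fun t : ℝ => ∫ v in Set.Ioi 0, partialDiff (v / t) * Real.exp (-v)) (𝓝[>] 0)
      (𝓝 0) := by
    refine tendsto_log_zeta_add_log.congr' ?_
    filter_upwards [self_mem_nhdsWithin] with t ht using (integral_partialDiff ht).symm
  rwa [sub_eq_zero.1 (tendsto_nhds_unique h h0)] at hC

/-- The contribution `-log (1 - 1/p) - 1/p` of the proper powers of `p` to `∑ 1 / (k p ^ k)`. -/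
noncomputable def properPowerSum (p : ℕ) : ℝ := -Real.log (1 - 1 / p) - 1 / p

lemma hasSum_properPowerSum {p : ℕ} (hp : 2 ≤ p) :
    HasSum (fun k : ℕ => if k = 0 then 0 else (1 / p : ℝ) ^ (k + 1) / (k + 1))
      (properPowerSum p) := by
  have hp' : (2 : ℝ) ≤ p := by exact_mod_cast hp
  have h := Real.hasSum_pow_div_log_of_abs_lt_one (x := 1 / (p : ℝ)) (by
    rw [abs_of_nonneg (by positivity), div_lt_one (by linarith)]; linarith)
  rw [← hasSum_nat_add_iff' 1] at h ⊢
  simpa [properPowerSum] using h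

lemma properPowerSum_nonneg {p : ℕ} (hp : 2 ≤ p) : 0 ≤ properPowerSum p :=
  (hasSum_properPowerSum hp).nonneg fun k => by split_ifs <;> positivity

lemma properPowerSum_le {p : ℕ} (hp : 2 ≤ p) : properPowerSum p ≤ 2 * (1 / (p : ℝ) ^ 2) := by
  have hp' : (2 : ℝ) ≤ p := by exact_mod_cast hp
  have h := Real.one_sub_inv_le_log_of_pos (x := 1 - 1 / (p : ℝ)) (by
    rw [sub_pos, div_lt_one (by linarith)]; linarith)
  have e : (1 - 1 / (p : ℝ))⁻¹ = p / (p - 1) := by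
    rw [one_sub_div (by positivity), inv_div]
  rw [e] at h
  have h2 : (p : ℝ) / (p - 1) - 1 - 1 / p = 1 / (p * (p - 1)) := by
    have : (p : ℝ) - 1 ≠ 0 := by linarith
    field_simp
    ring
  have h3 : 1 / ((p : ℝ) * (p - 1)) ≤ 2 * (1 / (p : ℝ) ^ 2) := by
    rw [mul_one_div, div_le_div_iff₀ (by nlinarith) (by positivity)]
    nlinarith
  rw [properPowerSum]
  linarith

lemma summable_properPowerSum : Summable fun p : Nat.Primes => properPowerSum p := by
  refine Summable.of_nonneg_of_le (fun p => properPowerSum_nonneg p.2.two_le)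
    (fun p => properPowerSum_le p.2.two_le) ?_
  exact ((Real.summable_one_div_nat_pow.2 one_lt_two).mul_left 2).comp_injective
    (i := fun p : Nat.Primes => (p : ℕ)) Subtype.coe_injective

lemma logZetaCoeff_prime_pow {p : ℕ} (hp : p.Prime) (k : ℕ) :
    logZetaCoeff (p ^ (k + 1)) = (1 / p : ℝ) ^ (k + 1) / (k + 1) := by
  have hlog : Real.log p ≠ 0 := (Real.log_pos (by exact_mod_cast hp.one_lt)).ne'
  have hp0 : (p : ℝ) ≠ 0 := by exact_mod_cast hp.ne_zero
  rw [logZetaCoeff, vonMangoldt_apply_pow (by omega), vonMangoldt_apply_prime hp]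
  push_cast
  rw [Real.log_pow, one_div_pow]
  push_cast
  field_simp

/-- Both series sum 1/(jp^j) over proper prime powers p^j, j ≥ 2: one groups the whole tail at p,
the other places each term at p^j. Nonnegativity permits the regrouping. -/
lemma exists_hasSum_nonprime :
    ∃ K : ℝ, HasSum (fun n : ℕ => if n.Prime then properPowerSum n else 0) K ∧
      HasSum (fun n : ℕ => if n.Prime then 0 else logZetaCoeff n) K := by
  set f : ℕ → ℝ := fun n => if n.Prime then 0 else logZetaCoeff n with hf
  have hfpow : ∀ (p : Nat.Primes) (k : ℕ),
      f (p ^ (k + 1)) = if k = 0 then 0 else (1 / (p : ℕ) : ℝ) ^ (k + 1) / (k + 1) := by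
    intro p k
    rcases eq_or_ne k 0 with rfl | hk
    · simp [hf, p.2]
    · have : ¬ ((p : ℕ) ^ (k + 1)).Prime := Nat.Prime.not_prime_pow (by omega)
      simp only [hf, this, if_false, hk, logZetaCoeff_prime_pow p.2]
  have hsum : ∀ p : Nat.Primes, HasSum (fun k => f ((p : ℕ) ^ (k + 1))) (properPowerSum p) := by
    intro p
    simp only [hfpow]
    exact hasSum_properPowerSum p.2.two_le
  have hf0 : ∀ n, 0 ≤ f n := fun n => by
    simp only [hf]; split_ifs
    exacts [le_rfl, logZetaCoeff_nonneg n]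
  have hprod : Summable fun q : Nat.Primes × ℕ => f ((q.1 : ℕ) ^ (q.2 + 1)) := by
    rw [summable_prod_of_nonneg fun q => hf0 _]
    refine ⟨fun p => (hsum p).summable, ?_⟩
    simp only [fun p : Nat.Primes => (hsum p).tsum_eq]
    exact summable_properPowerSum
  have h1 : HasSum (fun q : Nat.Primes × ℕ => f ((q.1 : ℕ) ^ (q.2 + 1)))
      (∑' p : Nat.Primes, properPowerSum p) := by
    have h := hprod.hasSum
    rwa [← (h.prod_fiberwise hsum).tsum_eq] at h
  refine ⟨_, (Nat.Primes.hasSum_iff_hasSum_ite properPowerSum).1 summable_properPowerSum.hasSum, ?_⟩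
  have h2 : HasSum (fun n : {n : ℕ // IsPrimePow n} => f n)
      (∑' p : Nat.Primes, properPowerSum p) := by
    rw [← Nat.Primes.prodNatEquiv.hasSum_iff]
    exact h1
  refine (hasSum_subtype_iff_of_support_subset (s := {n | IsPrimePow n}) ?_).1 h2
  intro n hn
  by_contra hpp
  refine hn ?_
  have : logZetaCoeff n = 0 := by
    rw [logZetaCoeff, vonMangoldt_eq_zero_iff.2 hpp, zero_div]
  simp only [hf, this, ite_self]

/-- **The third theorem of Mertens**, in logarithmic form. -/
theorem tendsto_sum_neg_log_one_sub_inv_sub_log_log :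
    Tendsto (fun n : ℕ => ∑ p ∈ range n with p.Prime, -Real.log (1 - 1 / (p : ℝ))
      - Real.log (Real.log n)) atTop (𝓝 Real.eulerMascheroniConstant) := by
  obtain ⟨K, h1, h2⟩ := exists_hasSum_nonprime
  -- The partial sums below n of the two groupings differ, but only by a null sequence.
  have h := tendsto_sum_logZetaCoeff_sub_log_log.add
    (h1.tendsto_sum_nat.sub h2.tendsto_sum_nat)
  rw [sub_self, add_zero] at h
  refine h.congr fun n => ?_
  rw [Finset.sum_filter, ← Finset.sum_sub_distrib, sub_add_eq_add_sub, ← Finset.sum_add_distrib]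
  congr 1
  refine Finset.sum_congr rfl fun p _ => ?_
  by_cases hp : p.Prime
  · have := logZetaCoeff_prime_pow hp 0
    simp only [zero_add, pow_one, Nat.cast_zero, div_one] at this
    simp only [hp, if_true, properPowerSum, this]
    ring
  · simp [hp]

end Mertens

/-! ### Landau's lower bound for the totient. -/

namespace Mertens

open Filter Topology Finset

lemma one_sub_one_div_prime_pos {p : ℕ} (hp : p.Prime) : (0 : ℝ) < 1 - 1 / p := by
  have : (1 : ℝ) < p := by exact_mod_cast hp.one_lt
  rw [sub_pos, div_lt_one (by linarith)]
  exact this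

lemma totient_div_eq_prod {n : ℕ} (hn : n ≠ 0) :
    (n.totient : ℝ) / n = ∏ p ∈ n.primeFactors, (1 - 1 / (p : ℝ)) := by
  have h := congrArg (fun q : ℚ => (q : ℝ)) (Nat.totient_eq_mul_prod_factors n)
  simp only [Rat.cast_natCast, Rat.cast_mul, Rat.cast_prod, Rat.cast_sub, Rat.cast_one,
    Rat.cast_inv] at h
  have hn' : (n : ℝ) ≠ 0 := by exact_mod_cast hn
  rw [h, mul_div_cancel_left₀ _ hn']
  simp only [one_div]

/-- The prime factors of `n` below `y`, where `y ≤ log n < y + 1`, contribute at most the product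
over all primes below `y` to `n / φ n`, and the others are few. -/
lemma exp_mul_le_totient_div {n y : ℕ} (hy : 2 ≤ y) (hn : 0 < n) (hlt : Real.log n ≤ y + 1) :
    Real.exp (-∑ p ∈ range y with p.Prime, -Real.log (1 - 1 / (p : ℝ))) * (1 - 2 / Real.log y)
      ≤ (n.totient : ℝ) / n := by
  have hy' : (2 : ℝ) ≤ y := by exact_mod_cast hy
  have hlogy : 0 < Real.log y := Real.log_pos (by linarith)
  rw [totient_div_eq_prod hn.ne', ← Finset.prod_filter_mul_prod_filter_not _ (fun p => p < y)]
  have hsmall : Real.exp (-∑ p ∈ range y with p.Prime, -Real.log (1 - 1 / (p : ℝ)))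
      ≤ ∏ p ∈ n.primeFactors with p < y, (1 - 1 / (p : ℝ)) := by
    have e : ∏ p ∈ n.primeFactors with p < y, (1 - 1 / (p : ℝ))
        = Real.exp (-∑ p ∈ n.primeFactors with p < y, -Real.log (1 - 1 / (p : ℝ))) := by
      rw [Finset.sum_neg_distrib, neg_neg, Real.exp_sum]
      refine Finset.prod_congr rfl fun p hp => ?_
      rw [Real.exp_log (one_sub_one_div_prime_pos
        (Nat.prime_of_mem_primeFactors (Finset.mem_filter.1 hp).1))]
    rw [e, Real.exp_le_exp, neg_le_neg_iff]
    refine Finset.sum_le_sum_of_subset_of_nonneg (fun p hp => ?_) fun p hp _ => ?_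
    · rw [Finset.mem_filter] at hp ⊢
      exact ⟨Finset.mem_range.2 hp.2, Nat.prime_of_mem_primeFactors hp.1⟩
    · have hp' := (Finset.mem_filter.1 hp).2
      rw [neg_nonneg]
      refine Real.log_nonpos (one_sub_one_div_prime_pos hp').le ?_
      rw [sub_le_self_iff]
      positivity
  have hpow : (1 - 1 / (y : ℝ)) ^ #{p ∈ n.primeFactors | ¬ p < y}
      ≤ ∏ p ∈ n.primeFactors with ¬ p < y, (1 - 1 / (p : ℝ)) := by
    rw [← Finset.prod_const]
    refine Finset.prod_le_prod (fun p _ => ?_) fun p hp => ?_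
    · rw [sub_nonneg, div_le_one (by linarith)]; linarith
    · have : (y : ℝ) ≤ p := by exact_mod_cast not_lt.1 (Finset.mem_filter.1 hp).2
      exact sub_le_sub_left (one_div_le_one_div_of_le (by linarith) this) 1
  -- The product of the prime factors that are at least y divides n, so y^count ≤ n.
  have hcard : #{p ∈ n.primeFactors | ¬ p < y} * Real.log y ≤ y + 1 := by
    refine le_trans ?_ hlt
    rw [← Real.log_pow]
    refine Real.log_le_log (by positivity) ?_
    have h1 : y ^ #{p ∈ n.primeFactors | ¬ p < y} ≤ ∏ p ∈ n.primeFactors with ¬ p < y, p :=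
      Finset.pow_card_le_prod _ _ _ fun p hp => not_lt.1 (Finset.mem_filter.1 hp).2
    have h2 : ∏ p ∈ n.primeFactors with ¬ p < y, p ∣ n :=
      (Finset.prod_dvd_prod_of_subset _ _ _ (Finset.filter_subset _ _)).trans
        (Nat.prod_primeFactors_dvd n)
    exact_mod_cast h1.trans (Nat.le_of_dvd hn h2)
  have hlarge : 1 - 2 / Real.log y ≤ ∏ p ∈ n.primeFactors with ¬ p < y, (1 - 1 / (p : ℝ)) := by
    refine le_trans ?_ hpow
    -- Bernoulli's inequality; the loss count/y is at most 2/log y because y + 1 ≤ 2y.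
    have hb := one_add_mul_le_pow (a := -(1 / (y : ℝ))) (by
      have : 1 / (y : ℝ) ≤ 1 := by rw [div_le_one (by linarith)]; linarith
      linarith) #{p ∈ n.primeFactors | ¬ p < y}
    refine le_trans ?_ (hb.trans_eq (by rw [← sub_eq_add_neg]))
    have : (#{p ∈ n.primeFactors | ¬ p < y} : ℝ) * (1 / y) ≤ 2 / Real.log y := by
      rw [mul_one_div, div_le_div_iff₀ (by linarith) hlogy]
      linarith
    linarith
  have hnn : 0 ≤ ∏ p ∈ n.primeFactors with ¬ p < y, (1 - 1 / (p : ℝ)) :=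
    Finset.prod_nonneg fun p hp => (one_sub_one_div_prime_pos
      (Nat.prime_of_mem_primeFactors (Finset.mem_filter.1 hp).1)).le
  exact (mul_le_mul_of_nonneg_left hlarge (Real.exp_nonneg _)).trans
    (mul_le_mul_of_nonneg_right hsmall hnn)

/-- `liminf φ(n) log log n / n ≥ e^{-γ}`. -/
theorem eventually_le_totient_div_mul_log_log {η : ℝ} (hη : 0 < η) :
    ∀ᶠ n : ℕ in atTop, Real.exp (-Real.eulerMascheroniConstant) - η
      ≤ (n.totient : ℝ) / n * Real.log (Real.log n) := by
  -- This is the preceding lower bound times log y, to be used at y = ⌊log n⌋.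
  have hw : Tendsto (fun y : ℕ => Real.exp (-(∑ p ∈ range y with p.Prime,
      -Real.log (1 - 1 / (p : ℝ)) - Real.log (Real.log y))) * (1 - 2 * (1 / Real.log (y + 0 : ℕ))))
      atTop (𝓝 (Real.exp (-Real.eulerMascheroniConstant) * (1 - 2 * 0))) :=
    ((Real.continuous_exp.tendsto _).comp tendsto_sum_neg_log_one_sub_inv_sub_log_log.neg).mul
      (((tendsto_inv_log_add 0).const_mul 2).const_sub 1)
  simp only [mul_zero, sub_zero, mul_one, add_zero] at hw
  have hy : Tendsto (fun n : ℕ => ⌊Real.log n⌋₊) atTop atTop :=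
    tendsto_nat_floor_atTop.comp (Real.tendsto_log_atTop.comp tendsto_natCast_atTop_atTop)
  filter_upwards [hy.eventually (hw.eventually (lt_mem_nhds (sub_lt_self _ hη))),
    hy.eventually (eventually_ge_atTop 2), eventually_gt_atTop 0] with n h1 h2 hn
  set y := ⌊Real.log n⌋₊ with hydef
  have hy' : (2 : ℝ) ≤ y := by exact_mod_cast h2
  have hlogy : 0 < Real.log y := Real.log_pos (by linarith)
  have hle : (y : ℝ) ≤ Real.log n := Nat.floor_le (Real.log_natCast_nonneg n)
  have h3 := exp_mul_le_totient_div h2 hn (Nat.lt_floor_add_one (Real.log n)).le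
  refine h1.le.trans ?_
  calc _ = Real.exp (-∑ p ∈ range y with p.Prime, -Real.log (1 - 1 / (p : ℝ)))
        * (1 - 2 / Real.log y) * Real.log y := by
        rw [neg_sub, sub_eq_add_neg, Real.exp_add, Real.exp_log hlogy]
        ring
    _ ≤ (n.totient : ℝ) / n * Real.log y := mul_le_mul_of_nonneg_right h3 hlogy.le
    _ ≤ _ := mul_le_mul_of_nonneg_left (Real.log_le_log (by linarith) hle) (by positivity)

/-- A real sequence which is eventually below every positive number is bounded by a positive
antitone null sequence. -/
lemma exists_antitone_majorant {g : ℕ → ℝ} (hg : ∀ η > 0, ∀ᶠ n in atTop, g n ≤ η) :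
    ∃ ε : ℕ → ℝ, Antitone ε ∧ (∀ n, 0 < ε n) ∧ Tendsto ε atTop (𝓝 0) ∧ ∀ n, g n ≤ ε n := by
  set h : ℕ → ℝ := fun n => max (g n) 0 with hh
  have hbdd : BddAbove (Set.range h) := by
    refine IsBoundedUnder.bddAbove_range ⟨1, eventually_map.2 ?_⟩
    filter_upwards [hg 1 one_pos] with n hn using max_le hn zero_le_one
  have hbdd' : ∀ n, BddAbove (Set.range fun k => h (n + k)) := fun n =>
    hbdd.mono (Set.range_subset_iff.2 fun k => Set.mem_range_self (n + k))
  have hle : ∀ n k, n ≤ k → h k ≤ ⨆ j, h (n + j) := by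
    intro n k hk
    obtain ⟨j, rfl⟩ := Nat.exists_eq_add_of_le hk
    exact le_ciSup (hbdd' n) j
  have hnn : ∀ n, 0 ≤ ⨆ j, h (n + j) := fun n => (le_max_right _ _).trans (hle n n le_rfl)
  -- The tail supremum is antitone but may vanish; 1/(n + 1) makes it strictly positive.
  refine ⟨fun n => (⨆ j, h (n + j)) + 1 / ((n : ℝ) + 1), ?_, fun n => ?_, ?_, fun n => ?_⟩
  · intro a b hab
    refine add_le_add (ciSup_le fun j => hle a (b + j) (by omega)) ?_
    exact one_div_le_one_div_of_le (by positivity) (by gcongr)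
  · have : 0 < 1 / ((n : ℝ) + 1) := by positivity
    have := hnn n
    positivity
  · have h1 : Tendsto (fun n => ⨆ j, h (n + j)) atTop (𝓝 0) := by
      refine Metric.tendsto_atTop.2 fun η hη => ?_
      obtain ⟨n₀, hn₀⟩ := eventually_atTop.1 (hg (η / 2) (by positivity))
      refine ⟨n₀, fun n hn => ?_⟩
      rw [Real.dist_eq, sub_zero, abs_of_nonneg (hnn n)]
      refine lt_of_le_of_lt (ciSup_le fun j => ?_) (half_lt_self hη)
      exact max_le (hn₀ _ (by omega)) (by positivity)
    simpa using h1.add tendsto_one_div_add_atTop_nhds_zero_nat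
  · have h1 : g n ≤ ⨆ j, h (n + j) := (le_max_left _ _).trans (hle n n le_rfl)
    have : 0 ≤ 1 / ((n : ℝ) + 1) := by positivity
    linarith

end Mertens

/-! ### Amplitudes and outcome probabilities. -/

namespace Shor

open Finset

lemma psi1_apply (L : ℕ) (x b : Reg L) :
    psi1 L (x, b) = if b = 0 then ((Real.sqrt ((2 ^ L : ℕ) : ℝ) : ℝ) : ℂ)⁻¹ else 0 := by
  rw [psi1, psi0, Matrix.mulVec_single_one]
  simp [Matrix.kroneckerMap_apply, fourier, Matrix.one_apply]

lemma psi2_apply (L : ℕ) (f : ℕ → ℕ) (x b : Reg L) :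
    psi2 L f (x, b)
      = if Fin.ofNat (2 ^ L) (f x) = b then ((Real.sqrt ((2 ^ L : ℕ) : ℝ) : ℝ) : ℂ)⁻¹ else 0 := by
  rw [psi2, Matrix.mulVec, dotProduct, Fintype.sum_prod_type, Finset.sum_eq_single x,
    Finset.sum_eq_single 0]
  · simp only [oracle, Matrix.of_apply, psi1_apply, zero_add, Prod.mk.injEq, true_and, if_true,
      ite_mul, one_mul, zero_mul, eq_comm]
  · intro c _ hc
    simp [psi1_apply, hc]
  · simp
  · intro x' _ hx'
    refine Finset.sum_eq_zero fun c _ => ?_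
    simp [oracle, hx'.symm]
  · simp

lemma psi3_apply (L : ℕ) (f : ℕ → ℕ) (y b : Reg L) :
    psi3 L f (y, b) = ((2 ^ L : ℕ) : ℂ)⁻¹
      * ∑ x ∈ univ.filter fun x : Reg L => Fin.ofNat (2 ^ L) (f x) = b, omega L ^ ((x : ℕ) * (y : ℕ)) := by
  have hs : ((Real.sqrt ((2 ^ L : ℕ) : ℝ) : ℝ) : ℂ) * ((Real.sqrt ((2 ^ L : ℕ) : ℝ) : ℝ) : ℂ)
      = ((2 ^ L : ℕ) : ℂ) := by
    rw [← Complex.ofReal_mul, Real.mul_self_sqrt (by positivity)]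
    push_cast; rfl
  rw [psi3, Matrix.mulVec, dotProduct, Fintype.sum_prod_type, Finset.mul_sum, Finset.sum_filter]
  refine Finset.sum_congr rfl fun x _ => ?_
  rw [Finset.sum_eq_single b]
  · simp only [Matrix.kroneckerMap_apply, fourier, Matrix.of_apply, Matrix.one_apply_eq,
      psi2_apply, mul_one]
    split_ifs with h
    · rw [← hs, mul_inv]; ring
    · simp
  · intro c _ hc
    simp [Matrix.kroneckerMap_apply, Matrix.one_apply_ne hc.symm]
  · simp

lemma prob_eq (L : ℕ) (f : ℕ → ℕ) (y : Reg L) :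
    prob L f y = ∑ b, (‖∑ x ∈ univ.filter fun x : Reg L => Fin.ofNat (2 ^ L) (f x) = b,
      omega L ^ ((x : ℕ) * (y : ℕ))‖ / ((2 ^ L : ℕ) : ℝ)) ^ 2 := by
  refine Finset.sum_congr rfl fun b _ => ?_
  rw [psi3_apply, norm_mul, norm_inv, Complex.norm_natCast, div_eq_inv_mul]

variable {N m : ℕ}

/-- m is a unit mod N, so its powers agree exactly when the exponents agree modulo its order. -/
lemma modExp_eq_modExp_iff (hm : Nat.Coprime m N) (a b : ℕ) :
    modExp N m a = modExp N m b ↔ a % period N m = b % period N m := by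
  have h1 : modExp N m a = modExp N m b ↔ (m : ZMod N) ^ a = (m : ZMod N) ^ b := by
    have := ZMod.natCast_eq_natCast_iff (m ^ a) (m ^ b) N
    push_cast at this
    rw [this]
    rfl
  have h2 : (m : ZMod N) = ((ZMod.unitOfCoprime m hm : (ZMod N)ˣ) : ZMod N) := by simp
  rw [h1, period, h2, orderOf_units, ← Units.val_pow_eq_pow_val, ← Units.val_pow_eq_pow_val,
    Units.val_inj, pow_eq_pow_iff_modEq]
  rfl

lemma period_pos (hN : 1 < N) (hm : Nat.Coprime m N) : 0 < period N m := by
  have : NeZero N := ⟨by omega⟩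
  rw [period, ← ZMod.coe_unitOfCoprime m hm, orderOf_units]
  exact orderOf_pos _

lemma period_lt (hN : 1 < N) (hm : Nat.Coprime m N) : period N m < N := by
  have : NeZero N := ⟨by omega⟩
  rw [period, ← ZMod.coe_unitOfCoprime m hm, orderOf_units]
  refine (orderOf_le_card_univ).trans_lt ?_
  rw [ZMod.card_units_eq_totient]
  exact Nat.totient_lt N hN

lemma filter_mod_eq_image {P r Q : ℕ} (hr : r < P) (hQ : r < Q) :
    {x ∈ range Q | x % P = r} = (range ((Q - 1 - r) / P + 1)).image fun k => r + k * P := by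
  have hP : 0 < P := by omega
  ext x
  simp only [Finset.mem_filter, Finset.mem_range, Finset.mem_image, Nat.lt_succ_iff,
    Nat.le_div_iff_mul_le hP]
  constructor
  · rintro ⟨hx, hmod⟩
    have := Nat.mod_add_div x P
    refine ⟨x / P, ?_, ?_⟩
    · rw [mul_comm]; omega
    · rw [mul_comm]; omega
  · rintro ⟨k, hk, rfl⟩
    refine ⟨by omega, ?_⟩
    rw [Nat.add_mul_mod_self_right, Nat.mod_eq_of_lt hr]

lemma sum_filter_mod_eq {P r Q : ℕ} (hr : r < P) (hQ : r < Q) (g : ℕ → ℂ) :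
    ∑ x ∈ range Q with x % P = r, g x = ∑ k ∈ range ((Q - 1 - r) / P + 1), g (r + k * P) := by
  rw [filter_mod_eq_image hr hQ, Finset.sum_image]
  intro a _ b _ hab
  exact Nat.eq_of_mul_eq_mul_right (by omega : 0 < P) (Nat.add_left_cancel hab)

/-- The outcome probabilities are bounded below by geometric sums over residue classes. -/
lemma sum_geom_le_prob {L : ℕ} (hN : 1 < N) (hm : Nat.Coprime m N) (hQ : N ^ 2 ≤ 2 ^ L)
    (y : Reg L) :
    ∑ r ∈ range (period N m), (‖∑ k ∈ range ((2 ^ L - 1 - r) / period N m + 1),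
      (omega L ^ (period N m * (y : ℕ))) ^ k‖ / ((2 ^ L : ℕ) : ℝ)) ^ 2
      ≤ prob L (modExp N m) y := by
  set P := period N m with hP
  have hPN : P < N := period_lt hN hm
  -- Values of f are below N ≤ Q, so reduction mod Q in the oracle merges none of them.
  have hNQ : N ≤ 2 ^ L := (Nat.le_self_pow two_ne_zero N).trans hQ
  have hval : ∀ x, ((Fin.ofNat (2 ^ L) (modExp N m x) : Reg L) : ℕ) = modExp N m x := fun x => by
    rw [Fin.val_ofNat, modExp, Nat.mod_eq_of_lt ((Nat.mod_lt _ (by omega)).trans_le hNQ)]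
  have hiff : ∀ x x', (Fin.ofNat (2 ^ L) (modExp N m x) : Reg L) = Fin.ofNat (2 ^ L) (modExp N m x')
      ↔ x % P = x' % P := fun x x' => by
    rw [Fin.ext_iff, hval, hval, modExp_eq_modExp_iff hm]
  rw [prob_eq]
  have hinj : Set.InjOn (fun r => (Fin.ofNat (2 ^ L) (modExp N m r) : Reg L)) (range P) := by
    intro r hr r' hr' hrr
    have := (hiff r r').1 hrr
    rwa [Nat.mod_eq_of_lt (Finset.mem_range.1 hr), Nat.mod_eq_of_lt (Finset.mem_range.1 hr')] at this
  refine le_trans (le_of_eq ?_) (Finset.sum_le_sum_of_subset_of_nonneg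
    (Finset.subset_univ ((range P).image fun r => (Fin.ofNat (2 ^ L) (modExp N m r) : Reg L)))
    fun _ _ _ => by positivity)
  rw [Finset.sum_image hinj]
  refine Finset.sum_congr rfl fun r hr => ?_
  have hr' := Finset.mem_range.1 hr
  congr 2
  have e : ∑ x ∈ univ.filter fun x : Reg L => (Fin.ofNat (2 ^ L) (modExp N m x) : Reg L)
        = Fin.ofNat (2 ^ L) (modExp N m r), omega L ^ ((x : ℕ) * (y : ℕ))
      = ∑ x ∈ range (2 ^ L) with x % P = r, omega L ^ (x * (y : ℕ)) := by
    rw [Finset.sum_filter, Finset.sum_filter, ← Fin.sum_univ_eq_sum_range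
      (fun x => if x % P = r then omega L ^ (x * (y : ℕ)) else 0)]
    refine Finset.sum_congr rfl fun x _ => ?_
    simp only [hiff, Nat.mod_eq_of_lt hr']
  rw [e, sum_filter_mod_eq hr' (by omega)]
  -- On the class of r the phase ω^{ry} factors out with modulus 1, leaving a geometric sum.
  have hn : ‖omega L‖ = 1 := (omega_primitive L).norm'_eq_one (by positivity)
  have e2 : ∀ k, omega L ^ ((r + k * P) * (y : ℕ))
      = omega L ^ (r * (y : ℕ)) * (omega L ^ (P * (y : ℕ))) ^ k := fun k => by
    rw [← pow_mul, ← pow_add]; congr 1; ring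
  simp only [e2, ← Finset.mul_sum, norm_mul, norm_pow, hn, one_pow, one_mul]

end Shor

/-! ### Lower bound for the probability of an outcome near dQ/P. -/

namespace Shor

open Finset

/-- The sum has norm |z^K - 1| / |z - 1|, with numerator 2|sin(Kφ/2)| and denominator at most |φ|.
The bound κ ≤ 1 serves the case φ = 0. -/
lemma mul_le_norm_geom_sum {κ φ : ℝ} {K : ℕ} (hκ : κ ≤ 1)
    (hs : κ * (K * |φ| / 2) ≤ Real.sin (K * |φ| / 2)) :
    κ * K ≤ ‖∑ k ∈ range K, Complex.exp (Complex.I * φ) ^ k‖ := by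
  rcases eq_or_ne φ 0 with rfl | hφ
  · simpa using mul_le_of_le_one_left (Nat.cast_nonneg (α := ℝ) K) hκ
  have hφ' : 0 < |φ| := abs_pos.2 hφ
  set z := Complex.exp (Complex.I * φ)
  have hz : z ^ K = Complex.exp (Complex.I * ((K * φ : ℝ) : ℂ)) := by
    rw [← Complex.exp_nat_mul]
    congr 1
    push_cast
    ring
  have h1 : ‖∑ k ∈ range K, z ^ k‖ * ‖z - 1‖ = ‖z ^ K - 1‖ := by
    rw [← norm_mul, geom_sum_mul]
  have h2 : ‖z - 1‖ ≤ |φ| := by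
    rw [Complex.norm_exp_I_mul_ofReal_sub_one, Real.norm_eq_abs, abs_mul, abs_two]
    have := Real.abs_sin_le_abs (x := φ / 2)
    rw [abs_div, abs_two] at this
    linarith
  have h3 : 2 * Real.sin (K * |φ| / 2) ≤ ‖z ^ K - 1‖ := by
    rw [hz, Complex.norm_exp_I_mul_ofReal_sub_one, Real.norm_eq_abs, abs_mul, abs_two]
    refine mul_le_mul_of_nonneg_left ?_ zero_le_two
    rcases abs_choice φ with h | h <;> rw [h]
    · exact le_abs_self _
    · rw [show (K : ℝ) * -φ / 2 = -(K * φ / 2) by ring, Real.sin_neg]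
      exact neg_le_abs _
  have h4 : ‖∑ k ∈ range K, z ^ k‖ * ‖z - 1‖ ≤ ‖∑ k ∈ range K, z ^ k‖ * |φ| :=
    mul_le_mul_of_nonneg_left h2 (norm_nonneg _)
  have h5 : κ * K * |φ| ≤ ‖∑ k ∈ range K, z ^ k‖ * |φ| := by linarith
  exact le_of_mul_le_mul_right h5 hφ'

/-- Up to π/2 this is Jordan's inequality. Beyond, the sine drops only quadratically: it is at least
1 - (5/4)δ², whereas the left side is at most (1-δ)(1+δ-δ²) = 1 - 2δ² + δ³. -/
lemma mul_le_sin_of_le {x ε δ : ℝ} (hx : 0 ≤ x) (hxε : x ≤ Real.pi / 2 * (1 + ε)) (hε : 0 ≤ ε)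
    (hεδ : ε ≤ δ - δ ^ 2) (hδ : δ ≤ 1 / 2) : 2 / Real.pi * (1 - δ) * x ≤ Real.sin x := by
  have hπ := Real.pi_pos
  have hδ0 : 0 ≤ δ := by nlinarith
  rcases le_total x (Real.pi / 2) with h | h
  · refine le_trans ?_ (Real.mul_le_sin hx h)
    have : 0 ≤ 2 / Real.pi * x := by positivity
    nlinarith
  · have h1 : 2 / Real.pi * (1 - δ) * x ≤ (1 - δ) * (1 + ε) := by
      have : 2 / Real.pi * x ≤ 1 + ε := by
        rw [div_mul_eq_mul_div, div_le_iff₀ hπ]; linarith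
      nlinarith
    have h2 : 1 - (x - Real.pi / 2) ^ 2 / 2 ≤ Real.sin x := by
      rw [← Real.cos_sub_pi_div_two]
      exact Real.one_sub_sq_div_two_le_cos
    have h3 : (x - Real.pi / 2) ^ 2 ≤ (Real.pi / 2 * ε) ^ 2 :=
      pow_le_pow_left₀ (by linarith) (by linarith) 2
    have h4 : (Real.pi / 2 * ε) ^ 2 ≤ 5 / 2 * ε ^ 2 := by
      have : Real.pi ^ 2 ≤ 10 := by nlinarith [Real.pi_lt_d2]
      nlinarith [sq_nonneg ε]
    have h5 : ε ^ 2 ≤ δ ^ 2 := pow_le_pow_left₀ hε (by nlinarith) 2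
    nlinarith

lemma omega_pow_eq_exp {L P : ℕ} (y : ℕ) (d : ℤ) :
    omega L ^ (P * y) = Complex.exp (Complex.I *
      ((2 * Real.pi * ((P * y - d * 2 ^ L : ℤ) : ℝ) / ((2 ^ L : ℕ) : ℝ) : ℝ) : ℂ)) := by
  rw [omega, ← Complex.exp_nat_mul, Complex.exp_eq_exp_iff_exists_int]
  refine ⟨d, ?_⟩
  push_cast
  field_simp
  ring

variable {N m L : ℕ}

/-- An outcome `y` close to a multiple of `Q / P` is measured with probability at least
`4 / (π² P) (1 - 1/N)²`. -/
lemma le_prob (h : Setup N m L) (y : Reg L) (d : ℤ)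
    (hd : 2 * |((period N m : ℤ) * (y : ℕ) - d * 2 ^ L)| ≤ period N m) :
    4 / Real.pi ^ 2 * (1 / period N m) * (1 - 1 / (N : ℝ)) ^ 2 ≤ prob L (modExp N m) y := by
  refine le_trans ?_ (sum_geom_le_prob h.one_lt h.coprime h.le_Q y)
  have hP0 := period_pos h.one_lt h.coprime
  have hPN := period_lt h.one_lt h.coprime
  have hNQ := h.le_Q
  have hN := h.one_lt
  set P := period N m
  have hQpos : (0 : ℝ) < ((2 ^ L : ℕ) : ℝ) := by positivity
  have hNQ' : (N : ℝ) ^ 2 ≤ ((2 ^ L : ℕ) : ℝ) := by exact_mod_cast hNQ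
  have hPQ : P ≤ 2 ^ L := hPN.le.trans ((Nat.le_self_pow two_ne_zero N).trans hNQ)
  have hP : (0 : ℝ) < P := by exact_mod_cast hP0
  have hPN' : (P : ℝ) + 1 ≤ N := by exact_mod_cast hPN
  have hN2 : (2 : ℝ) ≤ N := by exact_mod_cast hN
  have hπ := Real.pi_pos
  have hd' : 2 * |(((P : ℤ) * (y : ℕ) - d * 2 ^ L : ℤ) : ℝ)| ≤ P := by exact_mod_cast hd
  set Q : ℕ := 2 ^ L
  set e : ℝ := (((P : ℤ) * (y : ℕ) - d * 2 ^ L : ℤ) : ℝ)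
  set δ : ℝ := 1 / N with hδ
  have hδ0 : 0 ≤ δ := by positivity
  have hδ2 : δ ≤ 1 / 2 := one_div_le_one_div_of_le (by norm_num) hN2
  -- From P ≤ N - 1 and Q ≥ N², since (N-1)/N² = δ - δ² for δ = 1/N.
  have hε : (P : ℝ) / Q ≤ δ - δ ^ 2 := by
    have e1 : δ - δ ^ 2 = (N - 1) / N ^ 2 := by rw [hδ]; field_simp
    rw [e1]
    exact div_le_div₀ (by linarith) (by linarith) (by positivity) hNQ'
  have hterm : ∀ r ∈ range P, (2 / Real.pi * (1 - δ) / P) ^ 2 ≤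
      (‖∑ k ∈ range ((Q - 1 - r) / P + 1), (omega L ^ (P * (y : ℕ))) ^ k‖ / (Q : ℝ)) ^ 2 := by
    intro r hr
    rw [Finset.mem_range] at hr
    have hδ1 : 0 ≤ 1 - δ := by linarith
    refine pow_le_pow_left₀ (by positivity) ?_ 2
    rw [div_le_div_iff₀ hP hQpos, omega_pow_eq_exp _ d]
    set K := (Q - 1 - r) / P + 1 with hK
    have hK1 : K * P < Q + P := by
      have := Nat.div_mul_le_self (Q - 1 - r) P
      rw [hK, add_mul]
      omega
    have hK2 : Q < K * P + P := by
      have := Nat.lt_div_mul_add (a := Q - 1 - r) hP0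
      rw [hK, add_mul]
      omega
    have hK1' : (K : ℝ) * P ≤ Q + P := by exact_mod_cast hK1.le
    have hK2' : (Q : ℝ) ≤ K * P + P := by exact_mod_cast hK2.le
    set φ : ℝ := 2 * Real.pi * e / Q with hφ
    have hx : (K : ℝ) * |φ| / 2 ≤ Real.pi / 2 * (K * P / Q) := by
      have : |φ| = 2 * Real.pi * |e| / Q := by
        rw [hφ, abs_div, abs_mul, abs_of_pos (by positivity : 0 < 2 * Real.pi), abs_of_pos hQpos]
      rw [this]
      have e1 : (K : ℝ) * (2 * Real.pi * |e| / Q) / 2 = (Real.pi * K / Q / 2) * (2 * |e|) := by ring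
      have e2 : Real.pi / 2 * (K * P / Q) = (Real.pi * K / Q / 2) * P := by ring
      rw [e1, e2]
      exact mul_le_mul_of_nonneg_left hd' (by positivity)
    have hx0 : 0 ≤ (K : ℝ) * |φ| / 2 := by positivity
    have h2π : 2 / Real.pi ≤ 1 := by rw [div_le_one hπ]; linarith [Real.pi_gt_three]
    have h2π0 : 0 ≤ 2 / Real.pi := by positivity
    have hPQδ : (P : ℝ) ≤ δ * Q := by
      rw [div_le_iff₀ hQpos] at hε
      nlinarith [sq_nonneg δ]
    -- If KP ≤ Q, the half-angle stays within π/2 and the factor 1 - δ pays for K being too small.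
    -- Otherwise K ≥ Q/P suffices and 1 - δ pays for overshooting π/2. It is lost only once.
    rcases le_total ((K : ℝ) * P) Q with hcase | hcase
    · have hS := mul_le_norm_geom_sum (κ := 2 / Real.pi) (φ := φ) (K := K) h2π
        (Real.mul_le_sin hx0 (hx.trans (mul_le_of_le_one_right (by positivity)
          ((div_le_one hQpos).2 hcase))))
      refine le_trans ?_ (mul_le_mul_of_nonneg_right hS hP.le)
      rw [mul_assoc, mul_assoc]
      exact mul_le_mul_of_nonneg_left (by linarith) h2π0
    · have hκ : 2 / Real.pi * (1 - δ) ≤ 1 := by nlinarith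
      have hS := mul_le_norm_geom_sum (κ := 2 / Real.pi * (1 - δ)) (φ := φ) (K := K) hκ
        (mul_le_sin_of_le hx0 (hx.trans (mul_le_mul_of_nonneg_left (by
          rw [div_le_iff₀ hQpos, add_mul, div_mul_cancel₀ _ hQpos.ne']
          linarith) (by positivity))) (by positivity) hε hδ2)
      refine le_trans ?_ (mul_le_mul_of_nonneg_right hS hP.le)
      rw [mul_assoc _ (K : ℝ)]
      exact mul_le_mul_of_nonneg_left hcase (mul_nonneg h2π0 (by linarith))
  refine le_trans (le_of_eq ?_) (Finset.sum_le_sum hterm)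
  rw [Finset.sum_const, Finset.card_range, nsmul_eq_mul]
  field_simp
  ring

lemma exists_outcome_near (h : Setup N m L) {d : ℕ} (hd : d < period N m) :
    ∃ y : Reg L, 2 * |((period N m : ℤ) * (y : ℕ) - (d : ℤ) * 2 ^ L)| ≤ period N m := by
  have hPN := period_lt h.one_lt h.coprime
  have hNQ := h.le_Q
  have hPQ : period N m ≤ 2 ^ L := hPN.le.trans ((Nat.le_self_pow two_ne_zero N).trans hNQ)
  set P := period N m
  have hP0 : 0 < P := by omega
  have h1 := Nat.div_mul_le_self (2 * d * 2 ^ L + P) (2 * P)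
  have h2 := Nat.lt_div_mul_add (a := 2 * d * 2 ^ L + P) (by omega : 0 < 2 * P)
  -- Integer form of rounding dQ/P; it stays below Q because d ≤ P - 1 and P ≤ Q.
  set y := (2 * d * 2 ^ L + P) / (2 * P) with hy
  have hylt : y < 2 ^ L := by
    rw [hy, Nat.div_lt_iff_lt_mul (by omega)]
    have : (d + 1) * 2 ^ L ≤ P * 2 ^ L := Nat.mul_le_mul_right _ hd
    nlinarith [Nat.two_pow_pos L]
  refine ⟨⟨y, hylt⟩, ?_⟩
  zify at h1 h2
  have : |2 * ((P : ℤ) * (y : ℤ) - (d : ℤ) * 2 ^ L)| ≤ P := by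
    rw [abs_le]
    constructor <;> linarith
  rwa [abs_mul, abs_two] at this

/-- The distance is at most P/(2Q), and P < Q makes it strictly less than 1/2. Strictness rules out
ties in `round` and in the centred residue. -/
lemma near_bounds (h : Setup N m L) {y : Reg L} {d : ℤ}
    (hd : 2 * |((period N m : ℤ) * (y : ℕ) - d * 2 ^ L)| ≤ period N m) :
    |(period N m : ℚ) * (y : ℕ) / ((2 ^ L : ℕ) : ℚ) - d| < 1 / 2 := by
  have hPQ : period N m < 2 ^ L := (period_lt h.one_lt h.coprime).trans_le
    ((Nat.le_self_pow two_ne_zero N).trans h.le_Q)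
  have hQ : (0 : ℚ) < ((2 ^ L : ℕ) : ℚ) := by positivity
  have hd' : 2 * |(period N m : ℚ) * (y : ℕ) - d * ((2 ^ L : ℕ) : ℚ)| ≤ period N m := by
    exact_mod_cast hd
  have hPQ' : (period N m : ℚ) < ((2 ^ L : ℕ) : ℚ) := by exact_mod_cast hPQ
  rw [div_sub' hQ.ne', abs_div, abs_of_pos hQ, div_lt_iff₀ hQ, mul_comm _ (d : ℚ)]
  linarith

lemma mem_Y_of_near (h : Setup N m L) {y : Reg L} {d : ℤ}
    (hd : 2 * |((period N m : ℤ) * (y : ℕ) - d * 2 ^ L)| ≤ period N m) :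
    y ∈ Y L (period N m) := by
  have hb := abs_lt.1 (near_bounds h hd)
  have hc : ⌈(((period N m : ℤ) * ((y : ℕ) : ℤ) : ℤ) : ℚ) / ((2 ^ L : ℕ) : ℚ) - 1 / 2⌉ = d := by
    rw [Int.ceil_eq_iff]
    push_cast at hb ⊢
    constructor <;> linarith
  rw [Y, Set.mem_ofPred_eq, residue, hc, le_div_iff₀ two_pos, mul_comm]
  push_cast
  rw [mul_comm (2 ^ L : ℚ)]
  exact_mod_cast hd

lemma d_eq_of_near (h : Setup N m L) {y : Reg L} {d : ℤ}
    (hd : 2 * |((period N m : ℤ) * (y : ℕ) - d * 2 ^ L)| ≤ period N m) :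
    Shor.d L (period N m) y = d := by
  have hb := abs_lt.1 (near_bounds h hd)
  rw [Shor.d, round_eq, Int.floor_eq_iff, div_mul_eq_mul_div]
  constructor <;> linarith

/-! ### Success probability of one run and of repeated runs. -/

lemma sum_prob_le_goodProb {S : Finset (Reg L)} (hS : (S : Set (Reg L)) ⊆ good L (period N m)) :
    ∑ y ∈ S, prob L (modExp N m) y ≤ goodProb N m L := by
  refine le_trans (le_of_eq ?_) (MeasureTheory.measureReal_mono hS)
  rw [MeasureTheory.measureReal_def, PMF.toMeasure_apply_finset,
    ENNReal.toReal_sum fun y _ => PMF.apply_ne_top _ y]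
  refine Finset.sum_congr rfl fun y _ => ?_
  rw [source, PMF.ofFintype_apply, ENNReal.toReal_ofReal (prob_nonneg _ _ _)]

/-- Each d < P prime to P has its own good outcome, since d is recovered from y by rounding. This
gives φ(P) outcomes, each with the bound of `le_prob`. -/
theorem totient_div_le_goodProb (h : Setup N m L) :
    4 / Real.pi ^ 2 * (((period N m).totient : ℝ) / period N m) * (1 - 1 / (N : ℝ)) ^ 2
      ≤ goodProb N m L := by
  choose! y hy using fun (d : ℕ) (hd : d < period N m) => exists_outcome_near h hd
  set D := {d ∈ range (period N m) | (period N m).Coprime d} with hD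
  have hlt : ∀ d ∈ D, d < period N m := fun d hd => Finset.mem_range.1 (Finset.mem_filter.1 hd).1
  have hinj : Set.InjOn y D := by
    intro a ha b hb hab
    have h1 := d_eq_of_near h (hy a (hlt a ha))
    have h2 := d_eq_of_near h (hy b (hlt b hb))
    rw [hab, h2] at h1
    exact_mod_cast h1.symm
  have hsub : ((D.image y : Finset (Reg L)) : Set (Reg L)) ⊆ good L (period N m) := by
    intro z hz
    rw [Finset.mem_coe, Finset.mem_image] at hz
    obtain ⟨d, hd, rfl⟩ := hz
    refine ⟨mem_Y_of_near h (hy d (hlt d hd)), ?_⟩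
    rw [d_eq_of_near h (hy d (hlt d hd)), Int.gcd_natCast_natCast]
    exact (Finset.mem_filter.1 hd).2.symm
  refine le_trans ?_ (sum_prob_le_goodProb hsub)
  rw [Finset.sum_image hinj]
  refine le_trans (le_of_eq ?_)
    (Finset.sum_le_sum fun d hd => le_prob h (y d) d (hy d (hlt d hd)))
  rw [Finset.sum_const, nsmul_eq_mul, hD, ← Nat.totient_eq_card_coprime]
  ring

lemma one_le_lglg (h : Setup N m L) : 1 ≤ lglg N := by
  have hN4 : 4 ≤ N := by
    by_contra hc
    have h1 := h.one_lt
    have h2 := h.not_prime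
    interval_cases N <;> norm_num at h2
  have h2 : 2 ≤ Real.logb 2 N := by
    rw [Real.le_logb_iff_rpow_le one_lt_two (by positivity)]
    norm_num
    exact_mod_cast hN4
  rw [lglg, Real.le_logb_iff_rpow_le one_lt_two (by linarith)]
  simpa using h2

/-- The right side is log(lg N), and log P ≤ log N ≤ lg N. This conversion puts ln 2 into the final
constant. -/
lemma log_log_period_le (h : Setup N m L) :
    Real.log (Real.log (period N m)) ≤ lglg N * Real.log 2 := by
  have hl2 : 0 < Real.log 2 := Real.log_pos one_lt_two
  have hl2' : Real.log 2 ≤ 1 := by linarith [Real.log_two_lt_d9]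
  have h1 := one_le_lglg h
  have e : lglg N * Real.log 2 = Real.log (Real.logb 2 N) := by
    rw [lglg, Real.logb, div_mul_cancel₀ _ hl2.ne']
  rcases Nat.lt_or_ge 1 (period N m) with hp | hp
  · have hp' : (1 : ℝ) < period N m := by exact_mod_cast hp
    have hpN : (period N m : ℝ) ≤ N := by exact_mod_cast (period_lt h.one_lt h.coprime).le
    have hlp : 0 < Real.log (period N m) := Real.log_pos hp'
    have hle : Real.log (period N m) ≤ Real.log N := Real.log_le_log (by linarith) hpN
    rw [e]
    refine Real.log_le_log hlp (hle.trans ?_)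
    rw [Real.logb, le_div_iff₀ hl2]
    exact mul_le_of_le_one_right (hlp.le.trans hle) hl2'
  -- For P = 1 the left side is log 0 = 0 by convention.
  · have : period N m = 1 := le_antisymm hp (period_pos h.one_lt h.coprime)
    rw [this]
    simp
    positivity

lemma one_sub_one_div_sq_ge (h : Setup N m L) : (1 / 4 : ℝ) ≤ (1 - 1 / (N : ℝ)) ^ 2 := by
  have hN2 : (2 : ℝ) ≤ N := by exact_mod_cast h.one_lt
  have := one_div_le_one_div_of_le (by norm_num) hN2
  nlinarith

lemma goodProb_le_one : goodProb N m L ≤ 1 := MeasureTheory.measureReal_le_one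

/-- Total failure is a product set, so independence turns its probability into a power. -/
lemma successProb_eq (k : ℕ) : successProb N m L k = 1 - (1 - goodProb N m L) ^ k := by
  have e : {ys : Fin k → Reg L | ∃ i, ys i ∈ good L (period N m)}
      = (Set.univ.pi fun _ => (good L (period N m))ᶜ)ᶜ := by
    ext ys
    simp
  rw [successProb, e, MeasureTheory.probReal_compl_eq_one_sub (Set.toFinite _).measurableSet,
    MeasureTheory.measureReal_def, MeasureTheory.Measure.pi_pi, Finset.prod_const, Finset.card_fin,
    ENNReal.toReal_pow, ← MeasureTheory.measureReal_def,
    MeasureTheory.probReal_compl_eq_one_sub (Set.toFinite _).measurableSet]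
  rfl

lemma one_sub_exp_le_successProb {c C : ℝ} (hc : 0 < c) (hl : 1 ≤ lglg N)
    (hp : c * (1 / lglg N) ≤ goodProb N m L) :
    1 - Real.exp (-(c * C)) ≤ successProb N m L ⌈C * lglg N⌉₊ := by
  rw [successProb_eq]
  refine sub_le_sub_left ?_ 1
  have hl0 : 0 < lglg N := by linarith
  have hk : C * lglg N ≤ (⌈C * lglg N⌉₊ : ℝ) := Nat.le_ceil _
  set k := ⌈C * lglg N⌉₊
  set p := goodProb N m L
  have hp1 : p ≤ 1 := goodProb_le_one
  calc (1 - p) ^ k ≤ Real.exp (-p) ^ k :=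
        pow_le_pow_left₀ (by linarith) (Real.one_sub_le_exp_neg p) k
    _ = Real.exp (-(p * k)) := by rw [← Real.exp_nat_mul]; congr 1; ring
    _ ≤ Real.exp (-(c * C)) := by
      rw [Real.exp_le_exp, neg_le_neg_iff]
      calc c * C = c * (1 / lglg N) * (C * lglg N) := by field_simp
        _ ≤ c * (1 / lglg N) * k := mul_le_mul_of_nonneg_left hk (by positivity)
        _ ≤ p * k := mul_le_mul_of_nonneg_right hp k.cast_nonneg

theorem exists_error_sequence :
    ∃ ε : ℕ → ℝ, Antitone ε ∧ (∀ P, 0 < ε P) ∧ Filter.Tendsto ε Filter.atTop (nhds 0) ∧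
      ∀ N m L : ℕ, Setup N m L →
        4 / (Real.pi ^ 2 * Real.log 2) *
            ((Real.exp (-Real.eulerMascheroniConstant) - ε (period N m)) / lglg N) *
            (1 - 1 / (N : ℝ)) ^ 2
          ≤ goodProb N m L := by
  -- The error is the deficit in Landau's bound at P, a function of P alone and so uniform in N and
  -- m.
  obtain ⟨ε, h1, h2, h3, h4⟩ := Mertens.exists_antitone_majorant
    (g := fun n : ℕ => Real.exp (-Real.eulerMascheroniConstant)
      - (n.totient : ℝ) / n * Real.log (Real.log n)) fun η hη =>
      (Mertens.eventually_le_totient_div_mul_log_log hη).mono fun n hn => by linarith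
  refine ⟨ε, h1, h2, h3, fun N m L h => le_trans ?_ (totient_div_le_goodProb h)⟩
  have hl := one_le_lglg h
  have hl2 : 0 < Real.log 2 := Real.log_pos one_lt_two
  refine mul_le_mul_of_nonneg_right ?_ (sq_nonneg _)
  have hle : Real.exp (-Real.eulerMascheroniConstant) - ε (period N m)
      ≤ ((period N m).totient : ℝ) / period N m * (lglg N * Real.log 2) := by
    have := h4 (period N m)
    have h6 := mul_le_mul_of_nonneg_left (log_log_period_le h)
      (by positivity : 0 ≤ ((period N m).totient : ℝ) / period N m)
    linarith
  rw [← div_le_iff₀ (by positivity)] at hle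
  refine le_trans (le_of_eq ?_) (mul_le_mul_of_nonneg_left hle (by positivity))
  field_simp

theorem exists_le_goodProb :
    ∃ c : ℝ, 0 < c ∧ ∀ N m L : ℕ, Setup N m L → c * (1 / lglg N) ≤ goodProb N m L := by
  obtain ⟨ε, -, -, h3, h4⟩ := exists_error_sequence
  set E := Real.exp (-Real.eulerMascheroniConstant)
  have hE : 0 < E := Real.exp_pos _
  have hl2 : 0 < Real.log 2 := Real.log_pos one_lt_two
  obtain ⟨P₀, hP₀⟩ := Filter.eventually_atTop.1 (h3.eventually (gt_mem_nhds (half_pos hE)))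
  -- Beyond P₀ the error is below e^{-γ}/2. Below it the asymptotic bound may be void, so φ(P)/P ≥
  -- 1/(P₀ + 1) is used; the added 1 covers P₀ = 0.
  have hPpos : (0 : ℝ) < (P₀ : ℝ) + 1 := by positivity
  refine ⟨min (4 / (Real.pi ^ 2 * Real.log 2) * (E / 2) * (1 / 4))
    (4 / Real.pi ^ 2 * (1 / ((P₀ : ℝ) + 1)) * (1 / 4)), by positivity, fun N m L h => ?_⟩
  have hl := one_le_lglg h
  have hl0 : 0 < lglg N := by linarith
  have hsq := one_sub_one_div_sq_ge h
  rcases le_total P₀ (period N m) with hP | hP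
  · refine le_trans ?_ (h4 N m L h)
    refine (mul_le_mul_of_nonneg_right (min_le_left _ _) (by positivity)).trans ?_
    have hε : E / 2 ≤ E - ε (period N m) := by linarith [hP₀ _ hP]
    calc _ = 4 / (Real.pi ^ 2 * Real.log 2) * (E / 2 / lglg N) * (1 / 4) := by ring
      _ ≤ 4 / (Real.pi ^ 2 * Real.log 2) * ((E - ε (period N m)) / lglg N)
          * (1 - 1 / (N : ℝ)) ^ 2 := by
        have : 0 ≤ E - ε (period N m) := by linarith
        gcongr
  · refine le_trans ?_ (totient_div_le_goodProb h)
    refine (mul_le_mul_of_nonneg_right (min_le_right _ _) (by positivity)).trans ?_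
    have hp0 := period_pos h.one_lt h.coprime
    have hp0' : (0 : ℝ) < period N m := by exact_mod_cast hp0
    have hφ : (1 : ℝ) ≤ (period N m).totient := by exact_mod_cast Nat.totient_pos.2 hp0
    have hP' : (period N m : ℝ) ≤ (P₀ : ℝ) + 1 := by
      have : (period N m : ℝ) ≤ P₀ := by exact_mod_cast hP
      linarith
    have hd : 1 / ((P₀ : ℝ) + 1) ≤ ((period N m).totient : ℝ) / period N m :=
      div_le_div₀ (by positivity) hφ hp0' hP'
    have hinv : 1 / lglg N ≤ 1 := by rw [div_le_one hl0]; exact hl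
    calc _ ≤ 4 / Real.pi ^ 2 * (1 / ((P₀ : ℝ) + 1)) * (1 / 4) :=
          mul_le_of_le_one_right (by positivity) hinv
      _ ≤ _ := by gcongr

end Shor

theorem mainTheorem1 :
    (∃ ε : ℕ → ℝ, Antitone ε ∧ (∀ P, 0 < ε P) ∧ Filter.Tendsto ε Filter.atTop (nhds 0) ∧
      ∀ N m L : ℕ, Shor.Setup N m L →
        4 / (Real.pi ^ 2 * Real.log 2) *
            ((Real.exp (-Real.eulerMascheroniConstant) - ε (Shor.period N m)) / Shor.lglg N) *
            (1 - 1 / (N : ℝ)) ^ 2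
          ≤ Shor.goodProb N m L) ∧
    (∃ c : ℝ, 0 < c ∧ ∀ N m L : ℕ, Shor.Setup N m L →
      c * (1 / Shor.lglg N) ≤ Shor.goodProb N m L) ∧
    (∀ C : ℝ, 0 < C → ∃ δ : ℝ, 0 < δ ∧ ∀ N m L : ℕ, Shor.Setup N m L →
      δ ≤ Shor.successProb N m L ⌈C * Shor.lglg N⌉₊) := by
  obtain ⟨c, hc, hgood⟩ := Shor.exists_le_goodProb
  refine ⟨Shor.exists_error_sequence, ⟨c, hc, hgood⟩, fun C hC =>
    ⟨1 - Real.exp (-(c * C)), sub_pos.2 (Real.exp_lt_one_iff.2 (neg_neg_iff_pos.2 (mul_pos hc hC))),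
      fun N m L h => ?_⟩⟩
  exact Shor.one_sub_exp_le_successProb hc (Shor.one_le_lglg h) (hgood N m L h)
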